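/- **Theorem 1.** Write $\mathbb{R}_+=[0,\infty)$, $x^+=\max(x,0)$, and $|\cdot|$ for the Euclidean norm. Consider $$\dot y=f(y)+g(y)\big(u+\varphi'(y,w)\theta+A'(y,w)d\big),\qquad \dot w=h(y,w,\delta),$$ with $y\in\mathbb{R}^n$, $w\in\mathbb{R}^l$, $u\in\mathbb{R}$, $d\in\mathbb{R}^m$, $\theta\in\mathbb{R}^p$, $\delta\in\mathbb{R}^q$, where $f,g:\mathbb{R}^n\to\mathbb{R}^n$, $\varphi:\mathbb{R}^n\times\mathbb{R}^l\to\mathbb{R}^p$, $A:\mathbb{R}^n\times\mathbb{R}^l\to\mathbb{R}^m$, $h:\mathbb{R}^n\times\mathbb{R}^l\times\mathbb{R}^q\to\mathbb{R}^l$ are smooth and $f(0)=0$, $\varphi(0,0)=0$, $h(0,0,0)=0$. *Assumption (A).* There are smooth maps $V,Q:\mathbb{R}^n\to\mathbb{R}_+$, $k:\mathbb{R}^n\to\mathbb{R}$, $\Phi,R:\mathbb{R}^l\to\mathbb{R}_+$, $\mu:\mathbb{R}^n\to(0,\infty)$ with $k(0)=0$ and $V,Q,\Phi,R$ positive definite and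 radially unbounded (all sublevel sets compact), constants $r>0$, $\Lambda\ge 0$ and a non-decreasing continuous $\gamma:\mathbb{R}_+\to\mathbb{R}_+$ such that for all $y,w,\delta$ $$\nabla V(y)\big(f(y)+g(y)k(y)\big)\le -rQ(y),\qquad \nabla\Phi(w)h(y,w,\delta)\le -R(w)+\gamma(|\delta|)+Q(y),$$ $$|\varphi(y,w)-\varphi(y,0)|^2+|A(y,w)-A(y,0)|^2\le\mu(y)(R(w)+\Lambda),$$ $$|\varphi(y,0)|^2\le\mu(y)\big(Q(y)+\Lambda+(\nabla V(y)g(y))^2\big).$$ Suppose that (A) holds, and let $\varepsilon,\Gamma>0$, $a,\beta\in(0,1]$, $b,C\ge1$ with $2a\beta<br$. Apply the controller $$u=k(y)-C\mu^2(y)\tfrac{(b+e^z)^3}{a^3\beta^2}(\nabla V(y)g(y))^3-C\big(|A(y,0)|^2+|\varphi(y,0)|^2+\mu(y)+1\big)\tfrac{(b+e^z)^3}{a^3\beta^2}\nabla V(y)g(y),$$ $$\dot z=\Gamma e^{-z}(V(y)-\varepsilon)^+ ,\quad z\in\mathbb{R}.$$ Let $U(y,w)=V(y)+\frac r2\Phi(w)$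 and, for $s_1,\dots,s_4\ge0$, $$\chi(s_1,s_2,s_3,s_4)=\tfrac r2\gamma(s_2)+a\,\frac{s_1^2+s_1^4+\big((s_3-b-s_4)^+\big)^2+\big((s_3-b-s_4)^+\big)^4+2\beta\Lambda}{b+s_4}.$$ Then there exist $\omega\in KL$, $\zeta\in K_\infty$, a non-decreasing continuous $\tilde\zeta:\mathbb{R}_+\to\mathbb{R}_+$, with $\tilde\zeta(0)=0$ if $\gamma(0)=0$, and a continuous $B:\mathbb{R}^{n+l+1}\times\mathbb{R}^3\to\mathbb{R}$, such that for all $(y_0,w_0,z_0)\in\mathbb{R}^{n+l+1}$, $d\in L^\infty(\mathbb{R}_+;\mathbb{R}^m)$, $\theta\in L^\infty(\mathbb{R}_+;\mathbb{R}^p)$, $\delta\in L^\infty(\mathbb{R}_+;\mathbb{R}^q)$ the closed-loop system with $(y,w,z)(0)=(y_0,w_0,z_0)$ has a unique (Carathéodory) solution; it is defined for all $t\ge0$, $z$ is non-decreasing, $V(y(t))$ and $\Phi(w(t))$ are bounded, and $$\limsup_{t\to\infty}V(y(t))\le\varepsilon,\qquad \limsup_{t\to\infty}\Phi(w(t))\le\tilde\zeta\Big(\varepsilon+\limsup_{t\to\infty}|\delta(t)|\Big),$$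 $$U(y(t),w(t))\le\omega(U(y_0,w_0),t)+\zeta\big(\chi(\|d\|_\infty,\|\delta\|_\infty,\|\theta\|_\infty,e^{z_0})\big)\quad\text{for all }t\ge0,$$ $$z_0\le z(t)\le\lim_{s\to\infty}z(s)\le B(y_0,w_0,z_0,\|d\|_\infty,\|\delta\|_\infty,\|\theta\|_\infty)\quad\text{for all }t\ge0,$$ where the last limit exists and is finite. Moreover, if $\gamma(0)=\Lambda=0$, $\lim_{t\to\infty}d(t)=0$, $\lim_{t\to\infty}\delta(t)=0$ and $\theta$ is constant, then either $\lim_{t\to\infty}|y(t)|=\lim_{t\to\infty}|w(t)|=0$, or $|\theta|>b$ and $\lim_{s\to\infty}z(s)<\ln(|\theta|-b)$. Here $\|\cdot\|_\infty$ is the essential supremum norm, and limits superior, limits and constancy of the inputs $d,\theta,\delta$ are understood up to Lebesgue null sets. -/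

import Mathlib

open Set Filter Topology MeasureTheory
open scoped ContDiff

namespace DADS

/-- The space `ℝⁿ` with its Euclidean norm. -/
abbrev Vec (n : ℕ) : Type := EuclideanSpace ℝ (Fin n)

/-- Class `K`: (strictly) increasing continuous functions `ℝ₊ → ℝ₊` vanishing at `0`.
Only the values on `[0, ∞)` matter. -/
structure IsClassK (f : ℝ → ℝ) : Prop where
  continuousOn : ContinuousOn f (Ici 0)
  strictMonoOn : StrictMonoOn f (Ici 0)
  map_zero : f 0 = 0

/-- Class `K_∞`. -/
structure IsClassKInfty (f : ℝ → ℝ) : Prop where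
  isClassK : IsClassK f
  tendsto_atTop : Tendsto f atTop atTop

/-- Class `KL`. -/
structure IsClassKL (σ : ℝ → ℝ → ℝ) : Prop where
  continuousOn : ContinuousOn (fun x : ℝ × ℝ => σ x.1 x.2) (Ici 0 ×ˢ Ici 0)
  isClassK : ∀ t, 0 ≤ t → IsClassK (fun s => σ s t)
  antitoneOn : ∀ s, 0 ≤ s → AntitoneOn (fun t => σ s t) (Ici 0)
  tendsto_zero : ∀ s, 0 ≤ s → Tendsto (fun t => σ s t) atTop (𝓝 0)

/-- A non-decreasing function of class `C⁰(ℝ₊; ℝ₊)`. -/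
structure IsGainFunction (f : ℝ → ℝ) : Prop where
  continuousOn : ContinuousOn f (Ici 0)
  monotoneOn : MonotoneOn f (Ici 0)
  nonneg : ∀ s, 0 ≤ s → 0 ≤ f s

/-- Smooth, positive definite and radially unbounded. -/
structure IsSmoothProperPosDef {n : ℕ} (V : Vec n → ℝ) : Prop where
  smooth : ContDiff ℝ ∞ V
  map_zero : V 0 = 0
  pos : ∀ x, x ≠ 0 → 0 < V x
  radiallyUnbounded : ∀ M : ℝ, 0 < M → IsCompact {x | V x ≤ M}

/-- The plant
`ẏ = f(y) + g(y) (u + φ(y,w)ᵀ θ + A(y,w)ᵀ d)`, `ẇ = h(y,w,δ)`, with scalar input `u`. -/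
structure Plant (n l m p q : ℕ) where
  f : Vec n → Vec n
  g : Vec n → Vec n
  φ : Vec n → Vec l → Vec p
  A : Vec n → Vec l → Vec m
  h : Vec n → Vec l → Vec q → Vec l
  smooth_f : ContDiff ℝ ∞ f
  smooth_g : ContDiff ℝ ∞ g
  smooth_φ : ContDiff ℝ ∞ (fun x : Vec n × Vec l => φ x.1 x.2)
  smooth_A : ContDiff ℝ ∞ (fun x : Vec n × Vec l => A x.1 x.2)
  smooth_h : ContDiff ℝ ∞ (fun x : Vec n × Vec l × Vec q => h x.1 x.2.1 x.2.2)
  f_zero : f 0 = 0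
  φ_zero : φ 0 0 = 0
  h_zero : h 0 0 0 = 0

/-- The standing assumption on the plant: `V, Q, k, Φ, R, μ, r, Λ, γ` are as required.
Here `fderiv ℝ V y v` is `∇V(y) v`. -/
structure AssumptionA {n l m p q : ℕ} (S : Plant n l m p q)
    (V Q k : Vec n → ℝ) (Φ R : Vec l → ℝ) (μ : Vec n → ℝ)
    (r Λ : ℝ) (γ : ℝ → ℝ) : Prop where
  V_prop : IsSmoothProperPosDef V
  Q_prop : IsSmoothProperPosDef Q
  Φ_prop : IsSmoothProperPosDef Φ
  R_prop : IsSmoothProperPosDef R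
  k_smooth : ContDiff ℝ ∞ k
  k_zero : k 0 = 0
  μ_smooth : ContDiff ℝ ∞ μ
  μ_pos : ∀ y, 0 < μ y
  r_pos : 0 < r
  Λ_nonneg : 0 ≤ Λ
  γ_prop : IsGainFunction γ
  decrease_V : ∀ y, fderiv ℝ V y (S.f y + k y • S.g y) ≤ -r * Q y
  decrease_Φ : ∀ y w δ, fderiv ℝ Φ w (S.h y w δ) ≤ -R w + γ ‖δ‖ + Q y
  growth_w : ∀ y w, ‖S.φ y w - S.φ y 0‖ ^ 2 + ‖S.A y w - S.A y 0‖ ^ 2 ≤ μ y * (R w + Λ)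
  growth_y : ∀ y, ‖S.φ y 0‖ ^ 2 ≤ μ y * (Q y + Λ + (fderiv ℝ V y (S.g y)) ^ 2)

/-- The feedback law `u(y, z)`. -/
noncomputable def control {n l m p q : ℕ} (S : Plant n l m p q) (V k μ : Vec n → ℝ)
    (a β b C : ℝ) (y : Vec n) (z : ℝ) : ℝ :=
  k y
    - C * μ y ^ 2 * ((b + Real.exp z) ^ 3 / (a ^ 3 * β ^ 2)) * (fderiv ℝ V y (S.g y)) ^ 3
    - C * (‖S.A y 0‖ ^ 2 + ‖S.φ y 0‖ ^ 2 + μ y + 1)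
        * ((b + Real.exp z) ^ 3 / (a ^ 3 * β ^ 2)) * fderiv ℝ V y (S.g y)

/-- Right-hand side of the closed loop, with state `(y, w, z)`, for given inputs `d, θ, δ`. -/
noncomputable def closedLoop {n l m p q : ℕ} (S : Plant n l m p q) (V k μ : Vec n → ℝ)
    (ε Γ a β b C : ℝ) (d : ℝ → Vec m) (θ : ℝ → Vec p) (δ : ℝ → Vec q)
    (t : ℝ) (x : Vec n × Vec l × ℝ) : Vec n × Vec l × ℝ :=
  (S.f x.1 + (control S V k μ a β b C x.1 x.2.2
      + inner ℝ (S.φ x.1 x.2.1) (θ t) + inner ℝ (S.A x.1 x.2.1) (d t)) • S.g x.1,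
    S.h x.1 x.2.1 (δ t),
    Γ * Real.exp (-x.2.2) * max (V x.1 - ε) 0)

/-- Carathéodory solution of `ẋ = F(t, x)`, `x(0) = x₀` on an interval `I` with left endpoint
`0 ∈ I`: locally absolutely continuous and satisfying the equation almost everywhere, written
in the equivalent integrated form. -/
structure IsCaratheodorySolution {E : Type*} [NormedAddCommGroup E] [NormedSpace ℝ E]
    (F : ℝ → E → E) (x₀ : E) (I : Set ℝ) (x : ℝ → E) : Prop where
  continuousOn : ContinuousOn x I
  integrable : ∀ t ∈ I, IntervalIntegrable (fun s => F s (x s)) volume 0 t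
  eq_integral : ∀ t ∈ I, x t = x₀ + ∫ s in (0 : ℝ)..t, F s (x s)

/-- Membership in `L^∞(ℝ₊; ℝᵏ)`. -/
def IsLInfty {k : ℕ} (d : ℝ → Vec k) : Prop :=
  MemLp d ⊤ (volume.restrict (Ici (0 : ℝ)))

/-- The norm `‖d‖_∞` of `L^∞(ℝ₊; ℝᵏ)` (an essential supremum). -/
noncomputable def supNorm {k : ℕ} (d : ℝ → Vec k) : ℝ :=
  (eLpNorm d ⊤ (volume.restrict (Ici (0 : ℝ)))).toReal

/-- `t → +∞` up to Lebesgue null sets: a property holds eventually along this filter iff there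
is `T` such that it holds for almost every `t ≥ T`. -/
noncomputable def essAtTop : Filter ℝ := atTop ⊓ ae volume

/-- The function `χ`. -/
noncomputable def chi (γ : ℝ → ℝ) (r Λ a β b : ℝ) (s₁ s₂ s₃ s₄ : ℝ) : ℝ :=
  r / 2 * γ s₂
    + a * ((s₁ ^ 2 + s₁ ^ 4 + (max (s₃ - b - s₄) 0) ^ 2 + (max (s₃ - b - s₄) 0) ^ 4
        + 2 * β * Λ) / (b + s₄))

/-- The function `U(y, w) = V(y) + (r/2) Φ(w)`. -/
noncomputable def lyapU {n l : ℕ} (V : Vec n → ℝ) (Φ : Vec l → ℝ) (r : ℝ)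
    (y : Vec n) (w : Vec l) : ℝ :=
  V y + r / 2 * Φ w

end DADS

namespace DADS

/-! ### Carathéodory solutions: existence, uniqueness and Lyapunov estimates. -/

section Caratheodory

/-! By Young's inequality the nonlinear damping in the control absorbs the uncertain terms
(`damping_estimate`). What remains is V' ≤ -rQ + aβ/(b+e^z)·(Q+R+2Λ) plus a term depending only on
|d| and on the excess (|θ|-b-e^z)^+ of θ over the gain, divided by b+e^z. Adding r/2 times the
inequality for Φ gives U' ≤ -(r/2-aβ/b)(Q+R) + χ, with a positive rate because 2aβ < br. Since z
never decreases, χ stays below its value at z₀ and the input norms, and a K_∞ bound of U by Q+R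
yields the KL estimate (`AssumptionA.lyapU_le`).

The heart is the boundedness of the gain. A bound on U bounds R, so V' ≤ -P + M/(b+e^z) wherever V ≥
ε. As (e^z)' = Γ(V-ε)^+, the function ((V-ε)^+)²/2 + (P/Γ)e^z - (M/Γ)log(b+e^z) cannot increase
(`AssumptionA.antitoneOn_gainLyap`). The linear term beats the logarithm, so e^z is bounded and z
converges. Then ((V-ε)^+)² is a non-increasing function minus a convergent one, so it converges too.
A positive limit would make e^z grow linearly, hence limsup V ≤ ε, with no appeal to uniform
continuity (`AssumptionA.eventually_V_le`).

This bounds Q eventually and gives the estimate for Φ. With vanishing d, δ and constant θ, either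
the limiting gain lies below |θ|-b, or the excess tends to 0; then χ → 0 and U → 0.

Global solutions come from a truncated right-hand side, the a priori bounds showing that the
truncation is never active. Differential inequalities hold only almost everywhere and are used in
the integrated form `DerivBound`. -/

lemma ae_norm_le_of_nonneg {I : Type*} [NormedAddCommGroup I] {v : ℝ → I} {Mv : ℝ}
    (hvb : ∀ᵐ t ∂(volume.restrict (Ici (0 : ℝ))), ‖v t‖ ≤ Mv) :
    ∀ᵐ s ∂volume, 0 ≤ s → ‖v s‖ ≤ Mv := by
  rwa [ae_restrict_iff' measurableSet_Ici] at hvb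

/-- A continuous function on a compact interval is bounded. -/
lemma _root_.ContinuousOn.exists_norm_le_Icc {E : Type*} [NormedAddCommGroup E]
    {x : ℝ → E} {T : ℝ}
    (hx : ContinuousOn x (Icc 0 T)) :
    ∃ ρ, 0 < ρ ∧ ∀ t ∈ Icc 0 T, ‖x t‖ ≤ ρ := by
  obtain ⟨M, hM⟩ := isCompact_Icc.exists_bound_of_continuousOn hx
  exact ⟨max M 1, by positivity, fun t ht => (hM t ht).trans (le_max_left _ _)⟩

/-- A locally Lipschitz function is bounded and Lipschitz in the first variable on balls. -/
lemma _root_.LocallyLipschitz.exists_bound_lipschitz_ball {E I : Type*} [NormedAddCommGroup E]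
    [NormedAddCommGroup I] [ProperSpace E] [ProperSpace I] {G : E × I → E} 
    (hG : LocallyLipschitz G) (ρ Mv : ℝ) :
    ∃ M L : ℝ, 0 ≤ M ∧ 0 ≤ L ∧ (∀ x v, ‖x‖ ≤ ρ → ‖v‖ ≤ Mv → ‖G (x, v)‖ ≤ M) ∧
      ∀ x y v, ‖x‖ ≤ ρ → ‖y‖ ≤ ρ → ‖v‖ ≤ Mv → ‖G (x, v) - G (y, v)‖ ≤ L * ‖x - y‖ := by
  have hK : IsCompact (Metric.closedBall (0 : E) ρ ×ˢ Metric.closedBall (0 : I) Mv) :=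
    (isCompact_closedBall _ _).prod (isCompact_closedBall _ _)
  obtain ⟨M, hM⟩ := hK.exists_bound_of_continuousOn hG.continuous.continuousOn
  obtain ⟨L, hL⟩ := hG.locallyLipschitzOn.exists_lipschitzOnWith_of_compact hK
  refine ⟨max M 0, L, le_max_right _ _, L.2, fun x v hx hv => ?_, fun x y v hx hy hv => ?_⟩
  · exact (hM (x, v) ⟨by simpa using hx, by simpa using hv⟩).trans (le_max_left _ _)
  · have := hL.dist_le_mul (x, v) ⟨by simpa using hx, by simpa using hv⟩ (y, v)
      ⟨by simpa using hy, by simpa using hv⟩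
    simpa [dist_eq_norm, Prod.norm_def] using this

variable {E I : Type*} [NormedAddCommGroup E] [NormedSpace ℝ E] [NormedAddCommGroup I]

lemma IsCaratheodorySolution.mono {F : ℝ → E → E} {x₀ : E} {s t : Set ℝ} {x : ℝ → E}
    (h : IsCaratheodorySolution F x₀ t x) (hst : s ⊆ t) : IsCaratheodorySolution F x₀ s x :=
  ⟨h.continuousOn.mono hst, fun u hu => h.integrable u (hst hu),
    fun u hu => h.eq_integral u (hst hu)⟩

/-- The radial retraction onto the closed ball of radius `ρ`. -/
noncomputable def radialRetraction (ρ : ℝ) (x : E) : E := (ρ / max ρ ‖x‖) • x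

lemma radialRetraction_of_norm_le {ρ : ℝ} (hρ : 0 < ρ) {x : E} (hx : ‖x‖ ≤ ρ) :
    radialRetraction ρ x = x := by
  simp [radialRetraction, max_eq_left hx, hρ.ne']

lemma norm_radialRetraction_le {ρ : ℝ} (hρ : 0 < ρ) (x : E) : ‖radialRetraction ρ x‖ ≤ ρ := by
  have hm : 0 < max ρ ‖x‖ := lt_max_of_lt_left hρ
  rw [radialRetraction, norm_smul, Real.norm_of_nonneg (by positivity), div_mul_eq_mul_div,
    div_le_iff₀ hm]
  gcongr
  exact le_max_right _ _

/-- For ‖x‖ ≤ ‖y‖, split the difference into a multiple of x - y and a multiple of y; each part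
costs at most ‖x - y‖. The constant 2 holds in any normed space, which matters because the product
state space carries the sup norm. -/
lemma norm_radialRetraction_sub_le {ρ : ℝ} (hρ : 0 < ρ) (x y : E) :
    ‖radialRetraction ρ x - radialRetraction ρ y‖ ≤ 2 * ‖x - y‖ := by
  wlog hxy : ‖x‖ ≤ ‖y‖ generalizing x y
  · rw [norm_sub_rev, norm_sub_rev x]
    exact this y x (le_of_not_ge hxy)
  rcases le_or_gt ‖y‖ ρ with hy | hy
  · rw [radialRetraction_of_norm_le hρ hy, radialRetraction_of_norm_le hρ (hxy.trans hy)]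
    linarith [norm_nonneg (x - y)]
  have hy0 : 0 < ‖y‖ := hρ.trans hy
  have hm : 0 < max ρ ‖x‖ := lt_max_of_lt_left hρ
  set l := ρ / max ρ ‖x‖ with hl
  have hl0 : 0 ≤ l := by positivity
  have hl1 : l ≤ 1 := (div_le_one hm).2 (le_max_left _ _)
  have hly : ρ / ‖y‖ ≤ l := by
    apply div_le_div_of_nonneg_left hρ.le hm
    exact max_le hy.le hxy
  have hlx : l * ‖x‖ ≤ ρ := by
    rw [hl, div_mul_eq_mul_div, div_le_iff₀ hm]
    gcongr
    exact le_max_right _ _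
  have key : radialRetraction ρ x - radialRetraction ρ y
      = l • (x - y) + (l - ρ / ‖y‖) • y := by
    simp only [radialRetraction, max_eq_right hy.le, ← hl, smul_sub, sub_smul]
    abel
  have h1 : ‖y‖ - ‖x‖ ≤ ‖x - y‖ := by
    rw [norm_sub_rev]; exact norm_sub_norm_le _ _
  rw [key]
  calc ‖l • (x - y) + (l - ρ / ‖y‖) • y‖
      ≤ ‖l • (x - y)‖ + ‖(l - ρ / ‖y‖) • y‖ := norm_add_le _ _
    _ = l * ‖x - y‖ + (l - ρ / ‖y‖) * ‖y‖ := by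
        rw [norm_smul, norm_smul, Real.norm_of_nonneg hl0, Real.norm_of_nonneg (by linarith)]
    _ = l * ‖x - y‖ + (l * (‖y‖ - ‖x‖) + (l * ‖x‖ - ρ)) := by
        field_simp
        ring
    _ ≤ 1 * ‖x - y‖ + (1 * ‖x - y‖ + 0) := by
        have := mul_le_mul hl1 h1 (by linarith) zero_le_one
        gcongr
        linarith
    _ = 2 * ‖x - y‖ := by ring

lemma continuous_radialRetraction {ρ : ℝ} (hρ : 0 < ρ) :
    Continuous (radialRetraction ρ : E → E) := by
  have : LipschitzWith 2 (radialRetraction ρ : E → E) :=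
    LipschitzWith.of_dist_le_mul fun x y => by
      simpa [dist_eq_norm] using norm_radialRetraction_sub_le hρ x y
  exact this.continuous

open BoundedContinuousFunction in
/-- Global existence for bounded, globally Lipschitz right-hand sides. -/
lemma exists_solution_of_bounded_lipschitz [CompleteSpace E] {F : ℝ → E → E} {M L : ℝ}
    (hM : 0 ≤ M) (hL : 0 ≤ L)
    (hbound : ∀ᵐ t ∂(volume.restrict (Ici (0 : ℝ))), ∀ x, ‖F t x‖ ≤ M)
    (hlip : ∀ᵐ t ∂(volume.restrict (Ici (0 : ℝ))), ∀ x y, ‖F t x - F t y‖ ≤ L * ‖x - y‖)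
    (hmeas : ∀ x : ℝ → E, Continuous x →
      AEStronglyMeasurable (fun s => F s (x s)) (volume.restrict (Ici (0 : ℝ))))
    (x₀ : E) :
    ∃ x : ℝ → E, Continuous x ∧ IsCaratheodorySolution F x₀ (Ici 0) x := by
  -- The exponential weight e^{-lam t} makes the Picard map a contraction on the whole half-line:
  -- its constant is L / lam ≤ 1/2.
  set lam : ℝ := 2 * L + 1 with hlam
  have hlam0 : 0 < lam := by positivity
  have hint : ∀ x : ℝ → E, Continuous x → ∀ t, 0 ≤ t →
      IntervalIntegrable (fun s => F s (x s)) volume 0 t := by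
    intro x hx t ht
    rw [intervalIntegrable_iff_integrableOn_Ioc_of_le ht]
    have hsub : Ioc (0 : ℝ) t ⊆ Ici 0 := fun s hs => hs.1.le
    have hle : volume.restrict (Ioc (0 : ℝ) t) ≤ volume.restrict (Ici 0) :=
      Measure.restrict_mono hsub le_rfl
    refine Integrable.mono' (g := fun _ => M) (integrable_const M)
      ((hmeas x hx).mono_measure hle) ?_
    filter_upwards [ae_mono hle hbound] with s hs using hs _
  have hae : ∀ t : ℝ, ∀ P : ℝ → Prop, (∀ᵐ s ∂(volume.restrict (Ici (0 : ℝ))), P s) →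
      ∀ᵐ s ∂volume, s ∈ Ioc 0 t → P s := by
    intro t P h
    rw [ae_restrict_iff' measurableSet_Ici] at h
    filter_upwards [h] with s hs hs' using hs hs'.1.le
  -- The unknown `u` is the weighted solution and `lift u` the solution itself. Times are cut off at
  -- 0 because bounded continuous functions live on all of ℝ.
  set lift : (ℝ →ᵇ E) → ℝ → E := fun u s => Real.exp (lam * max s 0) • u s with hlift
  have hliftc : ∀ u, Continuous (lift u) := fun u => by
    have := u.continuous
    fun_prop
  set prim : (ℝ →ᵇ E) → ℝ → E := fun u t => x₀ + ∫ s in (0 : ℝ)..t, F s (lift u s) with hprim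
  have hprimc : ∀ u, Continuous fun t : ℝ => prim u (max t 0) := by
    intro u
    have h1 : ContinuousOn (prim u) (Ici 0) := by
      intro t ht
      have h2 : ContinuousOn (prim u) (Icc 0 (t + 1)) := by
        refine continuousOn_const.add ?_
        have h3 := (hint (lift u) (hliftc u) (t + 1) (by linarith [mem_Ici.1 ht]))
        rw [intervalIntegrable_iff_integrableOn_Icc_of_le (by linarith [mem_Ici.1 ht])] at h3
        have := intervalIntegral.continuousOn_primitive_interval (μ := volume)
          (f := fun s => F s (lift u s)) (a := 0) (b := t + 1)
          (by rwa [uIcc_of_le (by linarith [mem_Ici.1 ht])])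
        rwa [uIcc_of_le (by linarith [mem_Ici.1 ht])] at this
      have h4 := h2 t ⟨ht, by linarith⟩
      refine h4.mono_of_mem_nhdsWithin ?_
      rw [mem_nhdsWithin]
      exact ⟨Iio (t + 1), isOpen_Iio, by simp, fun s hs => ⟨hs.2, hs.1.le⟩⟩
    exact h1.comp_continuous (by fun_prop) fun t => mem_Ici.2 (le_max_right _ _)
  have hprimb : ∀ u t, 0 ≤ t → ‖prim u t‖ ≤ ‖x₀‖ + M * t := by
    intro u t ht
    refine (norm_add_le _ _).trans ?_
    gcongr
    have := intervalIntegral.norm_integral_le_of_norm_le (μ := volume)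
      (f := fun s => F s (lift u s)) (g := fun _ => M) ht
      (by filter_upwards [hae t _ hbound] with s hs hs' using hs hs' _) (by simp)
    simpa [mul_comm] using this
  have hexpb : ∀ t : ℝ, 0 ≤ t → t * Real.exp (-(lam * t)) ≤ 1 / lam := by
    intro t ht
    rw [Real.exp_neg, ← div_eq_mul_inv, div_le_div_iff₀ (Real.exp_pos _) hlam0]
    nlinarith [Real.add_one_le_exp (lam * t)]
  set T : (ℝ →ᵇ E) → (ℝ →ᵇ E) := fun u =>
    BoundedContinuousFunction.ofNormedAddCommGroup
      (fun t => Real.exp (-(lam * max t 0)) • prim u (max t 0))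
      ((by fun_prop : Continuous fun t : ℝ => Real.exp (-(lam * max t 0))).smul (hprimc u)) (‖x₀‖ + M * (1 / lam)) (by
        intro t
        have ht : 0 ≤ max t 0 := le_max_right _ _
        rw [norm_smul, Real.norm_of_nonneg (Real.exp_pos _).le]
        have h1 : Real.exp (-(lam * max t 0)) ≤ 1 := by
          rw [Real.exp_le_one_iff]; nlinarith
        calc Real.exp (-(lam * max t 0)) * ‖prim u (max t 0)‖
            ≤ Real.exp (-(lam * max t 0)) * (‖x₀‖ + M * max t 0) := by
              gcongr; exact hprimb u _ ht
          _ = Real.exp (-(lam * max t 0)) * ‖x₀‖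
              + M * (max t 0 * Real.exp (-(lam * max t 0))) := by ring
          _ ≤ 1 * ‖x₀‖ + M * (1 / lam) := by
              gcongr
              exact hexpb _ ht
          _ = _ := by ring) with hT
  have hcontr : ContractingWith (1 / 2) T := by
    refine ⟨by rw [← NNReal.coe_lt_coe]; norm_num, LipschitzWith.of_dist_le_mul fun u w => ?_⟩
    rw [BoundedContinuousFunction.dist_le (by positivity)]
    intro t
    set τ := max t 0 with hτ
    have hτ0 : 0 ≤ τ := le_max_right _ _
    have h1 : ‖∫ s in (0 : ℝ)..τ, (F s (lift u s) - F s (lift w s))‖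
        ≤ ∫ s in (0 : ℝ)..τ, L * dist u w * Real.exp (lam * s) := by
      refine intervalIntegral.norm_integral_le_of_norm_le hτ0 ?_
        (Continuous.intervalIntegrable (by fun_prop) _ _)
      filter_upwards [hae τ _ hlip] with s hs hs'
      refine (hs hs' _ _).trans ?_
      simp only [hlift, ← smul_sub, norm_smul, Real.norm_of_nonneg (Real.exp_pos _).le,
        max_eq_left hs'.1.le]
      have : ‖u s - w s‖ ≤ dist u w := by
        rw [← dist_eq_norm]; exact BoundedContinuousFunction.dist_coe_le_dist s
      calc L * (Real.exp (lam * s) * ‖u s - w s‖)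
          ≤ L * (Real.exp (lam * s) * dist u w) := by gcongr
        _ = _ := by ring
    have h2 : ∫ s in (0 : ℝ)..τ, L * dist u w * Real.exp (lam * s)
        = L * dist u w * ((Real.exp (lam * τ) - 1) / lam) := by
      rw [intervalIntegral.integral_const_mul, intervalIntegral.integral_comp_mul_left _ hlam0.ne']
      simp [integral_exp]
      left; field_simp
    have h3 : prim u τ - prim w τ = ∫ s in (0 : ℝ)..τ, (F s (lift u s) - F s (lift w s)) := by
      rw [intervalIntegral.integral_sub (hint _ (hliftc u) _ hτ0) (hint _ (hliftc w) _ hτ0)]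
      simp [hprim]
    change dist (Real.exp (-(lam * τ)) • prim u τ) (Real.exp (-(lam * τ)) • prim w τ) ≤ _
    rw [dist_eq_norm, ← smul_sub, norm_smul, Real.norm_of_nonneg (Real.exp_pos _).le, h3]
    calc Real.exp (-(lam * τ)) * ‖∫ s in (0 : ℝ)..τ, (F s (lift u s) - F s (lift w s))‖
        ≤ Real.exp (-(lam * τ)) * (L * dist u w * ((Real.exp (lam * τ) - 1) / lam)) := by
          gcongr; exact h1.trans_eq h2
      _ = L * dist u w / lam * (1 - Real.exp (-(lam * τ))) := by
          have : Real.exp (-(lam * τ)) * Real.exp (lam * τ) = 1 := by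
            rw [← Real.exp_add]; simp
          field_simp
          linear_combination L * dist u w * this
      _ ≤ L * dist u w / lam * 1 := by
          gcongr
          linarith [Real.exp_pos (-(lam * τ))]
      _ ≤ 1 / 2 * dist u w := by
          rw [mul_one, div_le_iff₀ hlam0]
          have : (0 : ℝ) ≤ dist u w := dist_nonneg
          nlinarith
      _ = ((1 / 2 : NNReal) : ℝ) * dist u w := by norm_num
  set u := ContractingWith.fixedPoint T hcontr
  have hu : T u = u := hcontr.fixedPoint_isFixedPt
  have hval : ∀ t, 0 ≤ t → lift u t = prim u t := by
    intro t ht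
    have h1 : u t = Real.exp (-(lam * t)) • prim u t := by
      conv_lhs => rw [← hu]
      change Real.exp (-(lam * max t 0)) • prim u (max t 0) = _
      rw [max_eq_left ht]
    simp only [hlift, max_eq_left ht]
    rw [h1, smul_smul, ← Real.exp_add]
    simp
  exact ⟨lift u, hliftc u, (hliftc u).continuousOn, fun t ht => hint _ (hliftc u) t ht,
    fun t ht => hval t ht⟩

variable [ProperSpace E] [ProperSpace I]

variable {G : E × I → E} {v : ℝ → I} {Mv : ℝ} {x₀ : E}

/-- Two Carathéodory solutions with the same initial value coincide. -/
lemma IsCaratheodorySolution.eqOn (hG : LocallyLipschitz G)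
    (hvb : ∀ᵐ t ∂(volume.restrict (Ici (0 : ℝ))), ‖v t‖ ≤ Mv) {T : ℝ} {x y : ℝ → E}
    (hx : IsCaratheodorySolution (fun t x => G (x, v t)) x₀ (Icc 0 T) x)
    (hy : IsCaratheodorySolution (fun t x => G (x, v t)) x₀ (Icc 0 T) y) :
    EqOn x y (Icc 0 T) := by
  obtain ⟨ρ₁, -, hρ₁⟩ := hx.continuousOn.exists_norm_le_Icc
  obtain ⟨ρ₂, -, hρ₂⟩ := hy.continuousOn.exists_norm_le_Icc
  obtain ⟨M, L, hM0, hL0, -, hL⟩ := hG.exists_bound_lipschitz_ball (max ρ₁ ρ₂) Mv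
  rcases lt_or_ge T 0 with hT | hT
  · rw [Icc_eq_empty (not_le.2 hT)]; exact eqOn_empty _ _
  -- Projecting times onto [0, T] makes the distance between the solutions continuous on all of ℝ.
  set e : ℝ → ℝ := fun s => ‖x (projIcc 0 T hT s) - y (projIcc 0 T hT s)‖ with he
  have hec : Continuous e := by
    have h1 := hx.continuousOn.domRestrict.comp (continuous_projIcc (h := hT))
    have h2 := hy.continuousOn.domRestrict.comp (continuous_projIcc (h := hT))
    exact (h1.sub h2).norm
  have he' : ∀ s ∈ Icc 0 T, e s = ‖x s - y s‖ := fun s hs => by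
    simp [he, projIcc_of_mem hT hs]
  have hkey : ∀ t ∈ Icc 0 T, e t ≤ L * ∫ s in (0 : ℝ)..t, e s := by
    intro t ht
    rw [he' t ht, hx.eq_integral t ht, hy.eq_integral t ht, add_sub_add_left_eq_sub,
      ← intervalIntegral.integral_sub (hx.integrable t ht) (hy.integrable t ht),
      ← intervalIntegral.integral_const_mul]
    refine intervalIntegral.norm_integral_le_of_norm_le ht.1 ?_
      ((hec.const_mul L).intervalIntegrable _ _)
    filter_upwards [ae_norm_le_of_nonneg hvb] with s hs hs'
    have hsT : s ∈ Icc 0 T := ⟨hs'.1.le, hs'.2.trans ht.2⟩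
    rw [he' s hsT]
    exact hL _ _ _ ((hρ₁ s hsT).trans (le_max_left _ _)) ((hρ₂ s hsT).trans (le_max_right _ _))
      (hs hs'.1.le)
  -- Gronwall is applied to the primitive of `e`, which is differentiable everywhere; `e` itself
  -- only satisfies an integral inequality.
  have hgr : ∀ t ∈ Icc 0 T, ‖∫ s in (0 : ℝ)..t, e s‖ ≤ gronwallBound 0 L 0 (t - 0) := by
    refine norm_le_gronwallBound_of_norm_deriv_right_le (f' := e) ?_ ?_ (by simp) ?_
    · exact (intervalIntegral.continuous_primitive (fun a b => hec.intervalIntegrable a b)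
        0).continuousOn
    · intro t _
      exact (hec.integral_hasStrictDerivAt 0 t).hasDerivAt.hasDerivWithinAt
    · intro t ht
      have h0 : 0 ≤ ∫ s in (0 : ℝ)..t, e s :=
        intervalIntegral.integral_nonneg ht.1 fun s _ => norm_nonneg _
      rw [Real.norm_of_nonneg h0, Real.norm_of_nonneg (norm_nonneg _), add_zero]
      exact hkey t ⟨ht.1, ht.2.le⟩
  intro t ht
  have h1 := hgr t ht
  rw [gronwallBound_ε0_δ0] at h1
  have h2 := hkey t ht
  rw [norm_le_zero_iff.1 h1, mul_zero, he' t ht] at h2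
  exact sub_eq_zero.1 (norm_le_zero_iff.1 h2)

/-- Global existence from an a priori bound on all solutions on compact intervals. -/
lemma exists_solution_of_apriori_bound [CompleteSpace E] (hG : LocallyLipschitz G)
    (hv : AEStronglyMeasurable v (volume.restrict (Ici (0 : ℝ))))
    (hvb : ∀ᵐ t ∂(volume.restrict (Ici (0 : ℝ))), ‖v t‖ ≤ Mv) {ρ : ℝ}
    (hap : ∀ T x, 0 ≤ T → IsCaratheodorySolution (fun t x => G (x, v t)) x₀ (Icc 0 T) x →
      ‖x T‖ < ρ) :
    ∃ x : ℝ → E, IsCaratheodorySolution (fun t x => G (x, v t)) x₀ (Ici 0) x := by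
  have hzero : IsCaratheodorySolution (fun t x => G (x, v t)) x₀ (Icc 0 0) (fun _ => x₀) := by
    refine ⟨continuousOn_const, fun t ht => ?_, fun t ht => ?_⟩ <;>
    · rw [Icc_self, mem_singleton_iff] at ht
      subst ht
      simp
  have hρ : 0 < ρ := (norm_nonneg _).trans_lt (hap 0 _ le_rfl hzero)
  obtain ⟨M, L, hM0, hL0, hM, hL⟩ := hG.exists_bound_lipschitz_ball ρ Mv
  obtain ⟨x, hxc, hx⟩ := exists_solution_of_bounded_lipschitz
    (F := fun t x => G (radialRetraction ρ x, v t)) (M := M) (L := L * 2) hM0 (by positivity)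
    (by filter_upwards [hvb] with t ht x using hM _ _ (norm_radialRetraction_le hρ x) ht)
    (by
      filter_upwards [hvb] with t ht x y
      refine (hL _ _ _ (norm_radialRetraction_le hρ x) (norm_radialRetraction_le hρ y) ht).trans ?_
      rw [mul_assoc]
      gcongr
      exact norm_radialRetraction_sub_le hρ x y)
    (by
      intro x hx
      exact hG.continuous.comp_aestronglyMeasurable
        (((continuous_radialRetraction hρ).comp hx).aestronglyMeasurable.prodMk hv)) x₀
  have hsol : ∀ T, (∀ s ∈ Icc 0 T, ‖x s‖ ≤ ρ) →
      IsCaratheodorySolution (fun t x => G (x, v t)) x₀ (Icc 0 T) x := by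
    intro T hT
    have hcongr : ∀ t ∈ Icc 0 T, EqOn (fun s => G (radialRetraction ρ (x s), v s))
        (fun s => G (x s, v s)) (uIcc 0 t) := by
      intro t ht s hs
      rw [uIcc_of_le ht.1] at hs
      simp only [radialRetraction_of_norm_le hρ (hT s ⟨hs.1, hs.2.trans ht.2⟩)]
    refine ⟨hxc.continuousOn, fun t ht => ?_, fun t ht => ?_⟩
    · exact (hx.integrable t ht.1).congr ((hcongr t ht).mono uIoc_subset_uIcc)
    · rw [hx.eq_integral t ht.1]
      congr 1
      exact intervalIntegral.integral_congr (hcongr t ht)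
  -- At the first time the norm reaches ρ the truncation has not yet acted, so the a priori bound
  -- applies there and its strictness is a contradiction.
  have hlt : ∀ t, 0 ≤ t → ‖x t‖ < ρ := by
    by_contra! hcon
    set S := {t : ℝ | 0 ≤ t ∧ ρ ≤ ‖x t‖} with hS
    have hSc : IsClosed S :=
      (isClosed_le continuous_const continuous_id).inter
        (isClosed_le continuous_const hxc.norm)
    have hSb : BddBelow S := ⟨0, fun t ht => ht.1⟩
    obtain ⟨h0, h1⟩ := hSc.csInf_mem hcon hSb
    set t₁ := sInf S
    have hbelow : ∀ s ∈ Ico 0 t₁, ‖x s‖ ≤ ρ := by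
      intro s hs
      by_contra! h
      exact absurd (csInf_le hSb (show s ∈ S from ⟨hs.1, h.le⟩)) (not_le.2 hs.2)
    have hclosed : ∀ s ∈ Icc 0 t₁, ‖x s‖ ≤ ρ := by
      rcases h0.eq_or_lt with h | h
      · intro s hs
        have : s = 0 := le_antisymm (hs.2.trans_eq h.symm) hs.1
        rw [this, hx.eq_integral 0 self_mem_Ici]
        simpa using (hap 0 _ le_rfl hzero).le
      · rw [← closure_Ico h.ne]
        exact closure_minimal hbelow (isClosed_le hxc.norm continuous_const)
    exact absurd (hap t₁ x h0 (hsol t₁ hclosed)) (not_lt.2 h1)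
  refine ⟨x, hxc.continuousOn, fun t ht => ?_, fun t ht => ?_⟩
  · exact (hsol t fun s hs => (hlt s hs.1).le).integrable t ⟨ht, le_rfl⟩
  · exact (hsol t fun s hs => (hlt s hs.1).le).eq_integral t ⟨ht, le_rfl⟩

/-- An absolutely continuous real function with a.e. derivative at most `c` has increments at
most `c` times the length of the interval. -/
lemma _root_.AbsolutelyContinuousOnInterval.sub_le_of_ae_deriv_le {f : ℝ → ℝ} {a b c : ℝ}
    (hab : a ≤ b) (hf : AbsolutelyContinuousOnInterval f a b)
    (h : ∀ᵐ s, s ∈ Ioo a b → deriv f s ≤ c) : f b - f a ≤ c * (b - a) := by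
  rw [← hf.integral_deriv_eq_sub]
  have h1 : ∫ s in a..b, deriv f s ≤ ∫ _ in a..b, c := by
    refine intervalIntegral.integral_mono_ae_restrict hab hf.intervalIntegrable_deriv (by simp) ?_
    rw [EventuallyLE, ae_restrict_iff' measurableSet_Icc]
    have ha : ∀ᵐ s : ℝ, s ≠ a := by simp [ae_iff, measure_singleton]
    have hb : ∀ᵐ s : ℝ, s ≠ b := by simp [ae_iff, measure_singleton]
    filter_upwards [h, ha, hb] with s hs hsa hsb hs'
    exact hs ⟨lt_of_le_of_ne hs'.1 hsa.symm, lt_of_le_of_ne hs'.2 hsb⟩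
  simpa [mul_comm] using h1

/-- Lyapunov-type estimate along a Carathéodory solution. -/
lemma IsCaratheodorySolution.sub_le_of_ae_deriv_le [CompleteSpace E] (hG : LocallyLipschitz G)
    (hvb : ∀ᵐ t ∂(volume.restrict (Ici (0 : ℝ))), ‖v t‖ ≤ Mv) {T : ℝ} {x : ℝ → E}
    (hx : IsCaratheodorySolution (fun t x => G (x, v t)) x₀ (Icc 0 T) x)
    {W : E → ℝ} (hW : LocallyLipschitz W) {t₁ t₂ c : ℝ} (h₁ : 0 ≤ t₁) (h₁₂ : t₁ ≤ t₂) (h₂ : t₂ ≤ T)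
    (h : ∀ᵐ s, s ∈ Ioo t₁ t₂ → HasDerivAt x (G (x s, v s)) s →
      ∃ D ≤ c, HasDerivAt (fun r => W (x r)) D s) :
    W (x t₂) - W (x t₁) ≤ c * (t₂ - t₁) := by
  obtain ⟨ρ, -, hρ⟩ := hx.continuousOn.exists_norm_le_Icc
  obtain ⟨M, L, hM0, hL0, hM, -⟩ := hG.exists_bound_lipschitz_ball ρ Mv
  have h0T : 0 ≤ T := h₁.trans (h₁₂.trans h₂)
  -- The inputs are essentially bounded, so the velocity is bounded along the trajectory. Lipschitz
  -- `x` makes `W ∘ x` absolutely continuous even when `W` is only locally Lipschitz.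
  have hxlip : LipschitzOnWith ⟨M, hM0⟩ x (Icc 0 T) := by
    refine LipschitzOnWith.of_dist_le_mul fun s hs t ht => ?_
    wlog hst : t ≤ s generalizing s t
    · rw [dist_comm, dist_comm s]
      exact this t ht s hs (le_of_not_ge hst)
    rw [dist_eq_norm, hx.eq_integral s hs, hx.eq_integral t ht, add_sub_add_left_eq_sub,
      intervalIntegral.integral_interval_sub_left (hx.integrable s hs) (hx.integrable t ht)]
    have := intervalIntegral.norm_integral_le_of_norm_le (μ := volume)
      (f := fun s => G (x s, v s)) (g := fun _ => M) hst
      (by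
        filter_upwards [ae_norm_le_of_nonneg hvb] with r hr hr'
        have h0r : 0 ≤ r := ht.1.trans hr'.1.le
        exact hM _ _ (hρ r ⟨h0r, hr'.2.trans hs.2⟩) (hr h0r)) (by simp)
    rw [Real.dist_eq, abs_of_nonneg (sub_nonneg.2 hst)]
    change _ ≤ M * (s - t)
    simpa [mul_comm] using this
  obtain ⟨K, hK⟩ := hW.locallyLipschitzOn.exists_lipschitzOnWith_of_compact
    (isCompact_closedBall (0 : E) ρ)
  have hWx : LipschitzOnWith (K * ⟨M, hM0⟩) (fun r => W (x r)) (Icc 0 T) :=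
    hK.comp hxlip fun t ht => by simpa using hρ t ht
  have hac : AbsolutelyContinuousOnInterval (fun r => W (x r)) t₁ t₂ := by
    refine (hWx.mono ?_).absolutelyContinuousOnInterval
    rw [uIcc_of_le h₁₂]
    exact Icc_subset_Icc h₁ h₂
  refine hac.sub_le_of_ae_deriv_le h₁₂ ?_
  filter_upwards [h, (hx.integrable T ⟨h0T, le_rfl⟩).ae_hasDerivAt_integral] with s hs hd hs'
  have hsT : s ∈ Ioo 0 T := ⟨h₁.trans_lt hs'.1, hs'.2.trans_le h₂⟩
  have hd1 := (hd (by rw [uIcc_of_le h0T]; exact Ioo_subset_Icc_self hsT) 0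
    (by simp)).const_add x₀
  have hd2 : HasDerivAt x (G (x s, v s)) s := by
    refine hd1.congr_of_eventuallyEq ?_
    filter_upwards [Ioo_mem_nhds hsT.1 hsT.2] with r hr
    exact hx.eq_integral r (Ioo_subset_Icc_self hr)
  obtain ⟨D, hD, hWD⟩ := hs hs' hd2
  rwa [hWD.deriv]

end Caratheodory

/-! ### Differential inequalities in integrated form. -/

/-- On `[0, T]` the increments of `v` are controlled by upper bounds of `g`; this is the
integrated form of the differential inequality `v' ≤ g`. -/
def DerivBound (v g : ℝ → ℝ) (T : ℝ) : Prop :=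
  ∀ t₁ t₂ c, 0 ≤ t₁ → t₁ ≤ t₂ → t₂ ≤ T → (∀ᵐ s, s ∈ Ioo t₁ t₂ → g s ≤ c) →
    v t₂ - v t₁ ≤ c * (t₂ - t₁)

lemma DerivBound.antitoneOn {v g : ℝ → ℝ} {T : ℝ} (h : DerivBound v g T)
    (hg : ∀ᵐ s, s ∈ Ioo 0 T → g s ≤ 0) : AntitoneOn v (Icc 0 T) := by
  intro t₁ h₁ t₂ h₂ h₁₂
  have := h t₁ t₂ 0 h₁.1 h₁₂ h₂.2 (by
    filter_upwards [hg] with s hs hs' using hs ⟨h₁.1.trans_lt hs'.1, hs'.2.trans_le h₂.2⟩)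
  linarith

/-- A sublevel set is forward invariant when the derivative is nonpositive above it. -/
lemma DerivBound.le_of_le {v g : ℝ → ℝ} {T l t₁ t₂ : ℝ} (h : DerivBound v g T)
    (hv : ContinuousOn v (Icc 0 T)) (h₁ : 0 ≤ t₁) (h₁₂ : t₁ ≤ t₂) (h₂ : t₂ ≤ T)
    (hg : ∀ᵐ s, s ∈ Ioo t₁ t₂ → l < v s → g s ≤ 0) (hl : v t₁ ≤ l) : v t₂ ≤ l := by
  by_contra! hcon
  have hc : ContinuousOn v (Icc t₁ t₂) := hv.mono (Icc_subset_Icc h₁ h₂)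
  set S := Icc t₁ t₂ ∩ v ⁻¹' Iic l with hS
  have hSc : IsClosed S := hc.preimage_isClosed_of_isClosed isClosed_Icc isClosed_Iic
  have hSb : BddAbove S := ⟨t₂, fun s hs => hs.1.2⟩
  have hmem := hSc.csSup_mem ⟨t₁, ⟨⟨le_rfl, h₁₂⟩, hl⟩⟩ hSb
  -- The last time in [t₁, t₂] at which v ≤ l; after it v lies above l and cannot increase.
  set τ := sSup S
  have hτ := h τ t₂ 0 (h₁.trans hmem.1.1) hmem.1.2 h₂ (by
    filter_upwards [hg] with s hs hs'
    have hs1 : t₁ < s := hmem.1.1.trans_lt hs'.1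
    refine hs ⟨hs1, hs'.2⟩ ?_
    by_contra! hle
    exact absurd (le_csSup hSb ⟨⟨hs1.le, hs'.2.le⟩, hle⟩) (not_le.2 hs'.1))
  have : v τ ≤ l := hmem.2
  linarith

/-- Either the level `l` has been reached, or `v` has decayed. -/
lemma DerivBound.le_or_decay {v g : ℝ → ℝ} {T l t : ℝ} (h : DerivBound v g T)
    (hv : ContinuousOn v (Icc 0 T)) {α : ℝ ≃o ℝ} (hα : α 0 = 0) (hl : 0 ≤ l)
    (hg : ∀ᵐ s, s ∈ Ioo 0 T → l < v s → g s ≤ -α (v s)) (ht : t ∈ Icc 0 T) :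
    v t ≤ l ∨ (0 ≤ v t ∧ α (v t) * t + v t ≤ v 0) := by
  refine or_iff_not_imp_left.2 fun hlt => ?_
  rw [not_le] at hlt
  have hαpos : ∀ r, l < r → 0 < α r := fun r hr => by
    rw [← hα]; exact α.strictMono (hl.trans_lt hr)
  have habove : ∀ s ∈ Icc 0 t, l < v s := by
    intro s hs
    by_contra! hle
    refine absurd (h.le_of_le hv hs.1 hs.2 ht.2 ?_ hle) (not_le.2 hlt)
    filter_upwards [hg] with r hr hr' hlr
    have := hr ⟨hs.1.trans_lt hr'.1, hr'.2.trans_le ht.2⟩ hlr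
    linarith [hαpos _ hlr]
  have hanti : ∀ s ∈ Icc 0 t, v t ≤ v s := by
    intro s hs
    have := h s t 0 hs.1 hs.2 ht.2 (by
      filter_upwards [hg] with r hr hr'
      have h0r := hs.1.trans_lt hr'.1
      have hlr := habove r ⟨h0r.le, hr'.2.le⟩
      linarith [hr ⟨h0r, hr'.2.trans_le ht.2⟩ hlr, hαpos _ hlr])
    linarith
  -- Since v does not drop below v(t) on [0, t], the rate α(v(s)) is at least the constant α(v(t)),
  -- so no comparison ODE has to be solved.
  have := h 0 t (-α (v t)) le_rfl ht.1 ht.2 (by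
    filter_upwards [hg] with r hr hr'
    have hr2 : r ∈ Icc 0 t := Ioo_subset_Icc_self hr'
    refine (hr ⟨hr'.1, hr'.2.trans_le ht.2⟩ (habove r hr2)).trans ?_
    exact neg_le_neg (α.monotone (hanti r hr2)))
  exact ⟨hl.trans hlt.le, by linarith⟩

/-- If the derivative is bounded away from zero above the level `l`, the level is reached. -/
lemma DerivBound.eventually_le {v g : ℝ → ℝ} {l η T₀ : ℝ} (h : ∀ T, DerivBound v g T)
    (hv : ContinuousOn v (Ici 0)) (hv0 : ∀ t, 0 ≤ t → 0 ≤ v t) (hη : 0 < η) (hT₀ : 0 ≤ T₀)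
    (hg : ∀ᵐ s, T₀ < s → l < v s → g s ≤ -η) : ∀ᶠ t in atTop, v t ≤ l := by
  obtain ⟨t₁, ht₁, hle⟩ : ∃ t₁, T₀ ≤ t₁ ∧ v t₁ ≤ l := by
    by_contra! hcon
    have hvT := hv0 T₀ hT₀
    -- Long enough that descent at rate η would force v(t) ≤ -η < 0.
    set t := T₀ + (v T₀ / η + 1) with ht
    have htT : T₀ ≤ t := by rw [ht]; have : 0 ≤ v T₀ / η := by positivity
                            linarith
    have := h t T₀ t (-η) hT₀ htT le_rfl (by
      filter_upwards [hg] with s hs hs' using hs hs'.1 (hcon s hs'.1.le))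
    have h2 : -η * (t - T₀) = -v T₀ - η := by rw [ht]; field_simp; ring
    linarith [hv0 t (hT₀.trans htT)]
  filter_upwards [eventually_ge_atTop t₁] with t ht
  refine (h t).le_of_le (hv.mono Icc_subset_Ici_self) (hT₀.trans ht₁) ht le_rfl ?_ hle
  filter_upwards [hg] with s hs hs' hl
  linarith [hs (ht₁.trans_lt hs'.1) hl]

/-! ### Comparison functions. -/

/-- Order isomorphisms of ℝ fixing 0 are the working form of K_∞ functions: continuity and a
globally defined monotone inverse come for free. -/
lemma _root_.OrderIso.isClassKInfty (σ : ℝ ≃o ℝ) (h0 : σ 0 = 0) : IsClassKInfty σ :=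
  ⟨⟨σ.continuous.continuousOn, σ.strictMono.strictMonoOn _, h0⟩, σ.tendsto_atTop⟩

lemma _root_.OrderIso.symm_apply_zero_of_apply_zero {σ : ℝ ≃o ℝ} (h0 : σ 0 = 0) :
    σ.symm 0 = 0 := by
  rw [OrderIso.symm_apply_eq, h0]

lemma _root_.OrderIso.map_nonneg_of_apply_zero {σ : ℝ ≃o ℝ} (h0 : σ 0 = 0) {s : ℝ} (hs : 0 ≤ s) :
    0 ≤ σ s := by
  rw [← h0]; exact σ.monotone hs

/-- The `KL` function attached to a decay rate `α`. -/
noncomputable def decayKL (α : ℝ ≃o ℝ) (s t : ℝ) : ℝ := α.symm ((α s + s) / (1 + t))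

lemma isClassKL_decayKL {α : ℝ ≃o ℝ} (hα : α 0 = 0) : IsClassKL (decayKL α) := by
  have hα' := OrderIso.symm_apply_zero_of_apply_zero hα
  refine ⟨?_, fun t ht => ⟨?_, ?_, ?_⟩, fun s hs => ?_, fun s hs => ?_⟩
  · refine α.symm.continuous.comp_continuousOn ?_
    refine ContinuousOn.div ?_ (by fun_prop) fun x hx => ?_
    · exact ((α.continuous.comp continuous_fst).add continuous_fst).continuousOn
    · have : 0 ≤ x.2 := hx.2
      positivity
  · refine (α.symm.continuous.comp ?_).continuousOn
    exact (α.continuous.add continuous_id).div_const _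
  · intro s _ s' _ hss
    refine α.symm.strictMono ?_
    have : 0 < 1 + t := by positivity
    gcongr
  · simp [decayKL, hα, hα']
  · intro t ht t' ht' htt
    refine α.symm.monotone ?_
    have h1 : 0 ≤ α s := OrderIso.map_nonneg_of_apply_zero hα hs
    have : 0 < 1 + t := by have := mem_Ici.1 ht; positivity
    gcongr
  · rw [← hα']
    refine (α.symm.continuous.tendsto 0).comp ?_
    exact tendsto_const_nhds.div_atTop (tendsto_atTop_add_const_left _ _ tendsto_id)

lemma decayKL_nonneg {α : ℝ ≃o ℝ} (hα : α 0 = 0) {s t : ℝ} (hs : 0 ≤ s) (ht : 0 ≤ t) :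
    0 ≤ decayKL α s t := by
  refine OrderIso.map_nonneg_of_apply_zero (OrderIso.symm_apply_zero_of_apply_zero hα) ?_
  have := OrderIso.map_nonneg_of_apply_zero hα hs
  positivity

/-- Adding α(r) ≤ α(s) to α(r)·t ≤ s gives α(r)(1 + t) ≤ α(s) + s. This explains the formula for
`decayKL`; the extra α(s) buys a denominator 1 + t that is regular at t = 0. -/
lemma le_decayKL {α : ℝ ≃o ℝ} {s r t : ℝ} (ht : 0 ≤ t) (hr : 0 ≤ r) (hα : α 0 = 0)
    (h : α r * t + r ≤ s) : r ≤ decayKL α s t := by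
  rw [decayKL, OrderIso.le_symm_apply, le_div_iff₀ (by positivity)]
  have h1 := OrderIso.map_nonneg_of_apply_zero hα hr
  have h2 : α r ≤ α s := α.monotone (by nlinarith)
  linarith

/-- A continuous function vanishing where the proper function `W₁` does is dominated by a
`K_∞` function of `W₁`. -/
lemma exists_orderIso_dominating {X : Type*} [TopologicalSpace X] {W₁ W₂ : X → ℝ}
    (h₁ : Continuous W₁) (h₂ : Continuous W₂) (hcpt : ∀ M, 0 < M → IsCompact {x | W₁ x ≤ M})
    (hpos : ∀ x, 0 ≤ W₁ x) (hpos₂ : ∀ x, 0 ≤ W₂ x) (hz : ∀ x, W₁ x = 0 → W₂ x = 0) :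
    ∃ σ : ℝ ≃o ℝ, σ 0 = 0 ∧ ∀ x, W₂ x ≤ σ (W₁ x) := by
  set m : ℝ → ℝ := fun s => sSup (W₂ '' {x | W₁ x ≤ s}) with hm
  have hbdd : ∀ s, BddAbove (W₂ '' {x | W₁ x ≤ s}) := by
    intro s
    have := (hcpt (max s 1) (by positivity)).bddAbove_image h₂.continuousOn
    have hsub : {x | W₁ x ≤ s} ⊆ {x | W₁ x ≤ max s 1} := fun x hx =>
      mem_ofPred.2 (le_trans (mem_ofPred.1 hx) (le_max_left s 1))
    exact this.mono (image_mono hsub)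
  have hm0 : ∀ s, 0 ≤ m s := fun s => Real.sSup_nonneg (by rintro _ ⟨x, _, rfl⟩; exact hpos₂ x)
  have hmle : ∀ s x, W₁ x ≤ s → W₂ x ≤ m s := fun s x hx => le_csSup (hbdd s) ⟨x, hx, rfl⟩
  have hmmono : Monotone m := by
    intro s t hst
    refine Real.sSup_le ?_ (hm0 t)
    rintro _ ⟨x, hx, rfl⟩
    exact hmle t x (le_trans hx hst)
  -- Compactness gives m(s) → 0 as s → 0: on the part of {W₁ ≤ 1} where W₂ ≥ η, W₁ has a positive
  -- minimum.
  have hmlim : ∀ η > 0, ∃ s > 0, m s ≤ η := by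
    intro η hη
    have hK : IsCompact ({x | W₁ x ≤ 1} ∩ {x | η ≤ W₂ x}) :=
      (hcpt 1 one_pos).inter_right (isClosed_le continuous_const h₂)
    obtain ⟨c, hc, hcK⟩ : ∃ c > 0, ∀ x, W₁ x ≤ 1 → η ≤ W₂ x → c ≤ W₁ x := by
      rcases eq_empty_or_nonempty ({x | W₁ x ≤ 1} ∩ {x | η ≤ W₂ x}) with he | hne
      · refine ⟨1, one_pos, fun x hx hx' => ?_⟩
        have hmem : x ∈ {x | W₁ x ≤ 1} ∩ {x | η ≤ W₂ x} := ⟨hx, hx'⟩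
        simp [he] at hmem
      · obtain ⟨x, hx, hxm⟩ := hK.exists_isMinOn hne h₁.continuousOn
        refine ⟨W₁ x, (hpos x).lt_of_ne fun h => ?_, fun y hy hy' => hxm ⟨hy, hy'⟩⟩
        have h3 : η ≤ W₂ x := hx.2
        rw [hz x h.symm] at h3
        linarith
    refine ⟨min 1 (c / 2), by positivity, Real.sSup_le ?_ hη.le⟩
    rintro _ ⟨x, hx, rfl⟩
    by_contra! hlt
    have := hcK x (le_trans hx (min_le_left _ _)) hlt.le
    have h4 : W₁ x ≤ c / 2 := le_trans hx (min_le_right _ _)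
    linarith
  have hint : ∀ a b, IntervalIntegrable m volume a b := fun a b => hmmono.intervalIntegrable
  -- The monotone `m` may jump. Averaging it over [s, 2s] restores continuity while keeping m(s) ≤
  -- F(s) ≤ m(2s).
  set F : ℝ → ℝ := fun s => ∫ τ in (1 : ℝ)..2, m (s * τ) with hF
  have hints : ∀ s, 0 ≤ s → IntervalIntegrable (fun τ => m (s * τ)) volume 1 2 := fun s hs =>
    Monotone.intervalIntegrable fun x y hxy => hmmono (mul_le_mul_of_nonneg_left hxy hs)
  have hFmono : MonotoneOn F (Ici 0) := by
    intro s hs t ht hst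
    refine intervalIntegral.integral_mono_on one_le_two (hints s hs) (hints t ht) fun τ hτ => ?_
    exact hmmono (mul_le_mul_of_nonneg_right hst (by linarith [hτ.1]))
  have hFle : ∀ s, 0 ≤ s → F s ≤ m (s * 2) := by
    intro s hs
    have := intervalIntegral.integral_mono_on one_le_two (hints s hs)
      (intervalIntegrable_const (c := m (s * 2))) fun τ hτ =>
        hmmono (mul_le_mul_of_nonneg_left hτ.2 hs)
    norm_num at this
    exact this
  have hleF : ∀ s, 0 ≤ s → m s ≤ F s := by
    intro s hs
    have := intervalIntegral.integral_mono_on one_le_two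
      (intervalIntegrable_const (c := m s)) (hints s hs) fun τ hτ => hmmono (by nlinarith [hτ.1])
    norm_num at this
    exact this
  have hF0 : F 0 = 0 := by
    refine le_antisymm ?_ ((hm0 0).trans (hleF 0 le_rfl))
    refine le_of_forall_pos_le_add fun η hη => ?_
    obtain ⟨s, hs, hsm⟩ := hmlim η hη
    have := hFle 0 le_rfl
    linarith [hmmono (show (0 : ℝ) * 2 ≤ s by linarith)]
  have hFc : ContinuousOn F (Ici 0) := by
    intro s hs
    rcases (mem_Ici.1 hs).eq_or_lt with h | h
    · subst h
      rw [ContinuousWithinAt, hF0, Metric.tendsto_nhdsWithin_nhds]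
      intro η hη
      obtain ⟨s, hs, hsm⟩ := hmlim (η / 2) (by positivity)
      refine ⟨s / 2, by positivity, fun {t} ht htd => ?_⟩
      rw [Real.dist_eq, sub_zero, abs_of_nonneg ht] at htd
      rw [Real.dist_eq, sub_zero, abs_of_nonneg ((hm0 t).trans (hleF t ht))]
      linarith [hFle t ht, hmmono (show t * 2 ≤ s by linarith)]
    · have hprim := intervalIntegral.continuous_primitive hint 0
      have heq : ∀ t, 0 < t → F t = t⁻¹ * ((∫ τ in (0 : ℝ)..t * 2, m τ) - ∫ τ in (0 : ℝ)..t, m τ) := by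
        intro t ht
        simp only [hF]
        rw [intervalIntegral.integral_comp_mul_left _ ht.ne',
          intervalIntegral.integral_interval_sub_left (hint _ _) (hint _ _)]
        simp
      have hcont : ContinuousAt
          (fun t => t⁻¹ * ((∫ τ in (0 : ℝ)..t * 2, m τ) - ∫ τ in (0 : ℝ)..t, m τ)) s := by
        refine (continuousAt_inv₀ h.ne').mul ?_
        exact ((hprim.comp (continuous_id.mul continuous_const)).sub hprim).continuousAt
      refine (hcont.congr ?_).continuousWithinAt
      filter_upwards [lt_mem_nhds h] with t ht using (heq t ht).symm
  -- The summand s makes the function strictly increasing and onto; for negative s it is the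
  -- identity because F(0) = 0.
  set f : ℝ → ℝ := fun s => F (max s 0) + s with hf
  have hfc : Continuous f :=
    (hFc.comp_continuous (by fun_prop) fun t => mem_Ici.2 (le_max_right _ _)).add continuous_id
  have hfm : StrictMono f := by
    intro s t hst
    have := hFmono (mem_Ici.2 (le_max_right s 0)) (mem_Ici.2 (le_max_right t 0))
      (max_le_max_right 0 hst.le)
    simp only [hf]
    linarith
  have hFnn : ∀ s, 0 ≤ F (max s 0) := fun s => (hm0 _).trans (hleF _ (le_max_right _ _))
  have hsurj : Function.Surjective f := by
    refine hfc.surjective ?_ ?_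
    · exact tendsto_atTop_mono (fun s => by simp only [hf, id]; linarith [hFnn s]) tendsto_id
    · refine (tendsto_id (α := ℝ)).congr' ?_
      filter_upwards [eventually_le_atBot 0] with s hs
      simp [hf, max_eq_right hs, hF0]
  refine ⟨hfm.orderIsoOfSurjective f hsurj, ?_, fun x => ?_⟩
  · simp [hf, hF0]
  · simp only [StrictMono.coe_orderIsoOfSurjective, hf, max_eq_left (hpos x)]
    linarith [hmle _ x le_rfl, hleF _ (hpos x), hpos x]

/-! ### Nonlinear damping and regularity of the closed loop. -/

/-- Weighted Young inequality: the defect is (2kp - q)²/(4k). -/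
lemma mul_le_add_sq_div {p q k : ℝ} (hk : 0 < k) : p * q ≤ k * p ^ 2 + q ^ 2 / (4 * k) := by
  have h : k * p ^ 2 + q ^ 2 / (4 * k) - p * q = (2 * k * p - q) ^ 2 / (4 * k) := by
    field_simp
    ring
  have : 0 ≤ (2 * k * p - q) ^ 2 / (4 * k) := by positivity
  linarith

/-- The domination of the uncertain terms by the nonlinear damping terms of the control law. -/
lemma damping_estimate {a β c C m l X₀ X Y₀ Y τ s D q R Λ : ℝ} (ha : 0 < a) (ha1 : a ≤ 1)
    (hβ : 0 < β) (hβ1 : β ≤ 1) (hc : 1 ≤ c) (hC : 1 ≤ C) (hm : 0 < m) (hl : 0 ≤ l)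
    (hX₀ : 0 ≤ X₀) (hX : 0 ≤ X) (hτ : τ ≤ c + s)
    (hXY : X ^ 2 + Y ^ 2 ≤ m * (R + Λ)) (hX₀b : X₀ ^ 2 ≤ m * (q + Λ + l ^ 2)) :
    l * (X₀ + X) * τ + l * (Y₀ + Y) * D
      - C * m ^ 2 * (c ^ 3 / (a ^ 3 * β ^ 2)) * l ^ 4
      - C * (Y₀ ^ 2 + X₀ ^ 2 + m + 1) * (c ^ 3 / (a ^ 3 * β ^ 2)) * l ^ 2
    ≤ a * β / c * (q + R + 2 * Λ) + a * ((s ^ 2 + s ^ 4 + D ^ 2 + D ^ 4) / c) := by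
  have hc0 : 0 < c := by linarith
  -- `G` is the gain in the control and `e` the share of Q + R that may be given up. The powers in
  -- `G` provide exactly e²G = c/a, c²/e ≤ G and 1/G ≤ a/c, which the Young inequalities below
  -- consume.
  set G := c ^ 3 / (a ^ 3 * β ^ 2) with hG
  set e := a * β / c with he
  have hG0 : 0 < G := by positivity
  have he0 : 0 < e := by positivity
  have heG : e ^ 2 * G = c / a := by
    rw [he, hG]; field_simp
  have hab1 : a ^ 2 * β ≤ 1 := mul_le_one₀ (pow_le_one₀ ha.le ha1) hβ.le hβ1
  have hcG : c ^ 2 / e ≤ G := by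
    rw [he, hG, div_div_eq_mul_div, div_le_div_iff₀ (by positivity) (by positivity)]
    have : c ^ 2 * c * (a ^ 3 * β ^ 2) = c ^ 3 * (a * β) * (a ^ 2 * β) := by ring
    rw [this]
    exact mul_le_of_le_one_right (by positivity) hab1
  have he1 : e ≤ 1 := by
    rw [he, div_le_one hc0]
    exact (mul_le_one₀ ha1 hβ.le hβ1).trans hc
  have hGc : c / a ≤ G := by
    rw [← heG]
    exact mul_le_of_le_one_left hG0.le (pow_le_one₀ he0.le he1)
  have hG1 : 1 ≤ G := by
    refine le_trans ?_ hGc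
    rw [le_div_iff₀ ha]; linarith
  have hac : 0 < a / c := by positivity
  have hGi : 1 / G ≤ a / c := by
    rw [div_le_div_iff₀ hG0 hc0]
    rw [div_le_iff₀ ha] at hGc
    linarith
  clear_value G e
  -- The part of θ of size c is paid for by the damping term G·m·l²: a quarter of it here, a half in
  -- the next estimate.
  have h1 : l * X₀ * c ≤ e / m * X₀ ^ 2 + G * m * l ^ 2 / 4 := by
    have := mul_le_add_sq_div (p := X₀) (q := l * c) (k := e / m) (by positivity)
    have h' : (l * c) ^ 2 / (4 * (e / m)) = c ^ 2 / e * (m * l ^ 2 / 4) := by field_simp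
    have h'' := mul_le_mul_of_nonneg_right hcG (by positivity : 0 ≤ m * l ^ 2 / 4)
    linarith
  have h2 : l * X * c ≤ e / m * X ^ 2 / 2 + G * m * l ^ 2 / 2 := by
    have := mul_le_add_sq_div (p := X) (q := l * c) (k := e / (2 * m)) (by positivity)
    have h' : (l * c) ^ 2 / (4 * (e / (2 * m))) = c ^ 2 / e * (m * l ^ 2 / 2) := by
      field_simp; ring
    have h'' := mul_le_mul_of_nonneg_right hcG (by positivity : 0 ≤ m * l ^ 2 / 2)
    have h3 : e / (2 * m) * X ^ 2 = e / m * X ^ 2 / 2 := by field_simp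
    linarith
  -- Used for X₀ with the excess s and for Y₀ with D; this spends the terms X₀² and Y₀² in the
  -- control.
  have h3 : ∀ Z r : ℝ, l * Z * r ≤ G * Z ^ 2 * l ^ 2 + a / c * r ^ 2 := by
    intro Z r
    have := mul_le_add_sq_div (p := l * Z) (q := r) (k := G) hG0
    have h' : r ^ 2 / (4 * G) = 1 / G * (r ^ 2 / 4) := by field_simp
    have h'' := mul_le_mul_of_nonneg_right hGi (by positivity : 0 ≤ r ^ 2 / 4)
    have : 0 ≤ a / c * r ^ 2 := by positivity
    have e1 : l * Z * r ≤ G * (l * Z) ^ 2 + a / c * (r ^ 2 / 4) := by linarith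
    linarith
  -- Z is controlled only through R, so Young is applied twice: first to split off Z², then to
  -- separate l² from r². This accounts for the cubic term of the control and the fourth powers in
  -- χ.
  have h4 : ∀ Z r : ℝ, l * Z * r ≤ e / m * Z ^ 2 / 2 + G * m ^ 2 * l ^ 4 / 4 + a / c * r ^ 4 := by
    intro Z r
    have i1 := mul_le_add_sq_div (p := Z) (q := l * r) (k := e / (2 * m)) (by positivity)
    have i2 := mul_le_add_sq_div (p := m * l ^ 2) (q := r ^ 2 / (2 * e)) (k := G / 4)
      (by positivity)
    have i3 : (l * r) ^ 2 / (4 * (e / (2 * m))) = m * l ^ 2 * (r ^ 2 / (2 * e)) := by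
      field_simp; ring
    have i4 : (r ^ 2 / (2 * e)) ^ 2 / (4 * (G / 4)) = r ^ 4 / (4 * (e ^ 2 * G)) := by
      field_simp; ring
    have i5 : r ^ 4 / (4 * (c / a)) = a / c * (r ^ 4 / 4) := by field_simp
    have i6 : e / (2 * m) * Z ^ 2 = e / m * Z ^ 2 / 2 := by field_simp
    rw [i3] at i1
    rw [i4, heG, i5] at i2
    have : 0 ≤ a / c * r ^ 4 := by positivity
    have e1 : l * Z * r = Z * (l * r) := by ring
    have e2 : G / 4 * (m * l ^ 2) ^ 2 = G * m ^ 2 * l ^ 4 / 4 := by ring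
    linarith
  have h5 : e / m * X ^ 2 + e / m * Y ^ 2 ≤ e * (R + Λ) := by
    have := mul_le_mul_of_nonneg_left hXY (by positivity : 0 ≤ e / m)
    have h' : e / m * (m * (R + Λ)) = e * (R + Λ) := by field_simp
    linarith
  -- The l² in the growth condition on φ(y, 0) is absorbed by the summand 1 in the control.
  have h6 : e / m * X₀ ^ 2 ≤ e * (q + Λ) + G * l ^ 2 := by
    have := mul_le_mul_of_nonneg_left hX₀b (by positivity : 0 ≤ e / m)
    have h' : e / m * (m * (q + Λ + l ^ 2)) = e * (q + Λ) + e * l ^ 2 := by field_simp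
    have h'' := mul_le_mul_of_nonneg_right (he1.trans hG1) (sq_nonneg l)
    linarith
  have h7 : l * (X₀ + X) * τ ≤ l * (X₀ + X) * (c + s) := by gcongr
  have h8 : m ^ 2 * G * l ^ 4 + (Y₀ ^ 2 + X₀ ^ 2 + m + 1) * G * l ^ 2
      ≤ C * (m ^ 2 * G * l ^ 4 + (Y₀ ^ 2 + X₀ ^ 2 + m + 1) * G * l ^ 2) :=
    le_mul_of_one_le_left (by positivity) hC
  have h9 : a * ((s ^ 2 + s ^ 4 + D ^ 2 + D ^ 4) / c)
      = a / c * s ^ 2 + a / c * s ^ 4 + a / c * D ^ 2 + a / c * D ^ 4 := by ring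
  have p1 : 0 ≤ G * m * l ^ 2 := by positivity
  have p2 : 0 ≤ G * m ^ 2 * l ^ 4 := by positivity
  have p3 : 0 ≤ e / m * Y ^ 2 := by positivity
  have := h3 X₀ s
  have := h3 Y₀ D
  have := h4 X s
  have := h4 Y D
  rw [h9]
  linarith

section System

variable {n l m p q : ℕ} {S : Plant n l m p q} {V Q k : Vec n → ℝ} {Φ R : Vec l → ℝ}
  {μ : Vec n → ℝ} {r Λ : ℝ} {γ : ℝ → ℝ} {ε Γ a β b C : ℝ}

/-- The derivative of `V` along the plant in closed loop. -/
lemma AssumptionA.fderiv_V_closedLoop_le (hA : AssumptionA S V Q k Φ R μ r Λ γ)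
    (ha : 0 < a) (ha1 : a ≤ 1) (hβ : 0 < β) (hβ1 : β ≤ 1) (hb : 1 ≤ b) (hC : 1 ≤ C)
    (y : Vec n) (w : Vec l) (z : ℝ) (θ : Vec p) (d : Vec m) :
    fderiv ℝ V y (S.f y + (control S V k μ a β b C y z + inner ℝ (S.φ y w) θ
      + inner ℝ (S.A y w) d) • S.g y)
    ≤ -r * Q y + a * β / (b + Real.exp z) * (Q y + R w + 2 * Λ)
      + a * (((max (‖θ‖ - b - Real.exp z) 0) ^ 2 + (max (‖θ‖ - b - Real.exp z) 0) ^ 4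
        + ‖d‖ ^ 2 + ‖d‖ ^ 4) / (b + Real.exp z)) := by
  set L := fderiv ℝ V y (S.g y) with hL
  set c := b + Real.exp z with hc
  set s := max (‖θ‖ - b - Real.exp z) 0 with hs
  have hc1 : 1 ≤ c := by have := Real.exp_pos z; linarith
  have hτ : ‖θ‖ ≤ c + s := by have := le_max_left (‖θ‖ - b - Real.exp z) 0; linarith
  have hdec := hA.decrease_V y
  rw [map_add, map_smul, smul_eq_mul, ← hL] at hdec
  rw [map_add, map_smul, smul_eq_mul, ← hL]
  have hn : ∀ {j : ℕ} (f₁ f₀ v : Vec j), inner ℝ f₁ v * L ≤ |L| * (‖f₀‖ + ‖f₁ - f₀‖) * ‖v‖ := by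
    intro j f₁ f₀ v
    calc inner ℝ f₁ v * L ≤ |inner ℝ f₁ v * L| := le_abs_self _
      _ = |inner ℝ f₁ v| * |L| := abs_mul _ _
      _ ≤ (‖f₁‖ * ‖v‖) * |L| := by gcongr; exact abs_real_inner_le_norm _ _
      _ ≤ ((‖f₀‖ + ‖f₁ - f₀‖) * ‖v‖) * |L| := by
          gcongr
          exact norm_le_norm_add_norm_sub' _ _
      _ = _ := by ring
  have h1 := hn (S.φ y w) (S.φ y 0) θ
  have h2 := hn (S.A y w) (S.A y 0) d
  have h3 := damping_estimate (Y₀ := ‖S.A y 0‖) (D := ‖d‖) ha ha1 hβ hβ1 hc1 hC (hA.μ_pos y)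
    (abs_nonneg L)
    (norm_nonneg (S.φ y 0)) (norm_nonneg (S.φ y w - S.φ y 0)) hτ (hA.growth_w y w)
    (by rw [sq_abs]; exact hA.growth_y y)
  have hsq : |L| ^ 4 = L ^ 4 := by rw [show (4 : ℕ) = 2 * 2 by rfl, pow_mul, sq_abs, ← pow_mul]
  rw [hsq, sq_abs] at h3
  have h4 : control S V k μ a β b C y z * L = k y * L
      - C * μ y ^ 2 * (c ^ 3 / (a ^ 3 * β ^ 2)) * L ^ 4
      - C * (‖S.A y 0‖ ^ 2 + ‖S.φ y 0‖ ^ 2 + μ y + 1) * (c ^ 3 / (a ^ 3 * β ^ 2)) * L ^ 2 := by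
    simp only [control, ← hL, ← hc]
    ring
  rw [add_mul, add_mul, h4]
  linarith

/-- The closed loop as a map of the state and of the values of the inputs. -/
noncomputable def closedLoopMap (S : Plant n l m p q) (V k μ : Vec n → ℝ) (ε Γ a β b C : ℝ)
    (x : (Vec n × Vec l × ℝ) × (Vec m × Vec p × Vec q)) : Vec n × Vec l × ℝ :=
  closedLoop S V k μ ε Γ a β b C (fun _ => x.2.1) (fun _ => x.2.2.1) (fun _ => x.2.2.2) 0 x.1

/-- Everything is smooth except (V - ε)^+ in the gain dynamics, which is why the solution theory
asks only for local Lipschitz continuity. -/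
lemma AssumptionA.locallyLipschitz_closedLoopMap (hA : AssumptionA S V Q k Φ R μ r Λ γ) :
    LocallyLipschitz (closedLoopMap S V k μ ε Γ a β b C) := by
  have hV := hA.V_prop.smooth
  have hV' : ContDiff ℝ ∞ fun y => fderiv ℝ V y (S.g y) :=
    (hV.fderiv_right (m := ∞) (by simp)).clm_apply S.smooth_g
  have hk := hA.k_smooth
  have hμ := hA.μ_smooth
  have hf := S.smooth_f
  have hg := S.smooth_g
  have hφ0 : ContDiff ℝ ∞ fun y => S.φ y 0 :=
    S.smooth_φ.comp (contDiff_id.prodMk contDiff_const)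
  have hA0 : ContDiff ℝ ∞ fun y => S.A y 0 :=
    S.smooth_A.comp (contDiff_id.prodMk contDiff_const)
  have hφ0n : ContDiff ℝ ∞ fun y => ‖S.φ y 0‖ ^ 2 := hφ0.norm_sq ℝ
  have hA0n : ContDiff ℝ ∞ fun y => ‖S.A y 0‖ ^ 2 := hA0.norm_sq ℝ
  let X := (Vec n × Vec l × ℝ) × (Vec m × Vec p × Vec q)
  have hy : ContDiff ℝ ∞ fun x : X => x.1.1 := by fun_prop
  have hw : ContDiff ℝ ∞ fun x : X => x.1.2.1 := by fun_prop
  have hz : ContDiff ℝ ∞ fun x : X => x.1.2.2 := by fun_prop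
  have hctrl : ContDiff ℝ ∞ fun x : X => control S V k μ a β b C x.1.1 x.1.2.2 := by
    have hexp : ContDiff ℝ ∞ fun x : X => (b + Real.exp x.1.2.2) ^ 3 / (a ^ 3 * β ^ 2) := by
      fun_prop
    exact ((hk.comp hy).sub (((contDiff_const.mul ((hμ.comp hy).pow 2)).mul hexp).mul
      ((hV'.comp hy).pow 3))).sub (((contDiff_const.mul ((((hA0n.comp hy).add
        (hφ0n.comp hy)).add (hμ.comp hy)).add contDiff_const)).mul hexp).mul (hV'.comp hy))
  have h1 : ContDiff ℝ ∞ fun x : X => (closedLoopMap S V k μ ε Γ a β b C x).1 := by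
    refine (hf.comp hy).add (ContDiff.smul ((hctrl.add ?_).add ?_) (hg.comp hy))
    · exact (S.smooth_φ.comp (hy.prodMk hw)).inner ℝ (by fun_prop)
    · exact (S.smooth_A.comp (hy.prodMk hw)).inner ℝ (by fun_prop)
  have h2 : ContDiff ℝ ∞ fun x : X => (closedLoopMap S V k μ ε Γ a β b C x).2.1 :=
    S.smooth_h.comp (hy.prodMk (hw.prodMk (by fun_prop)))
  have h3 : LocallyLipschitz fun x : X => (closedLoopMap S V k μ ε Γ a β b C x).2.2 := by
    have i1 : LocallyLipschitz fun x : X => (x.1.2.2, max (V x.1.1 - ε) 0) := by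
      refine LocallyLipschitz.prodMk (hz.of_le (by simp)).locallyLipschitz ?_
      exact ((((hV.comp hy).sub contDiff_const).of_le (by simp)).locallyLipschitz).max_const 0
    have i2 : ContDiff ℝ 1 fun u : ℝ × ℝ => Γ * Real.exp (-u.1) * u.2 := by fun_prop
    exact i2.locallyLipschitz.comp i1
  exact (h1.of_le (by simp)).locallyLipschitz.prodMk
    ((h2.of_le (by simp)).locallyLipschitz.prodMk h3)

end System

/-! ### Differential inequalities along solutions. -/

lemma supNorm_nonneg {j : ℕ} (d : ℝ → Vec j) : 0 ≤ supNorm d := ENNReal.toReal_nonneg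

lemma IsLInfty.ae_norm_le {j : ℕ} {d : ℝ → Vec j} (hd : IsLInfty d) :
    ∀ᵐ t ∂(volume.restrict (Ici (0 : ℝ))), ‖d t‖ ≤ supNorm d := by
  have h1 : eLpNorm d ⊤ (volume.restrict (Ici (0 : ℝ))) ≠ ⊤ := hd.2.ne
  have h2 := ae_le_eLpNormEssSup (f := d) (μ := volume.restrict (Ici (0 : ℝ)))
  filter_upwards [h2] with t ht
  rw [← eLpNorm_exponent_top] at ht
  have := ENNReal.toReal_mono h1 ht
  simpa [supNorm] using this

section System

variable {n l m p q : ℕ} {S : Plant n l m p q} {V Q k : Vec n → ℝ} {Φ R : Vec l → ℝ}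
  {μ : Vec n → ℝ} {r Λ : ℝ} {γ : ℝ → ℝ} {ε Γ a β b C : ℝ}
  {d : ℝ → Vec m} {θ : ℝ → Vec p} {δ : ℝ → Vec q} {x₀ : Vec n × Vec l × ℝ} {T : ℝ}
  {x : ℝ → Vec n × Vec l × ℝ}

lemma ae_norm_inputs_le (hd : IsLInfty d) (hθ : IsLInfty θ) (hδ : IsLInfty δ) :
    ∀ᵐ t ∂(volume.restrict (Ici (0 : ℝ))),
      ‖(d t, θ t, δ t)‖ ≤ max (supNorm d) (max (supNorm θ) (supNorm δ)) := by
  filter_upwards [hd.ae_norm_le, hθ.ae_norm_le, hδ.ae_norm_le] with t h1 h2 h3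
  simp only [Prod.norm_def]
  gcongr

lemma ae_inputs_le (hd : IsLInfty d) (hθ : IsLInfty θ) (hδ : IsLInfty δ) :
    ∀ᵐ t, 0 ≤ t → ‖d t‖ ≤ supNorm d ∧ ‖θ t‖ ≤ supNorm θ ∧ ‖δ t‖ ≤ supNorm δ := by
  filter_upwards [ae_norm_le_of_nonneg hd.ae_norm_le, ae_norm_le_of_nonneg hθ.ae_norm_le,
    ae_norm_le_of_nonneg hδ.ae_norm_le] with t h1 h2 h3 h0 using ⟨h1 h0, h2 h0, h3 h0⟩

/-- Differential inequalities along solutions of the closed loop. -/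
lemma AssumptionA.derivBound (hA : AssumptionA S V Q k Φ R μ r Λ γ)
    (hd : IsLInfty d) (hθ : IsLInfty θ) (hδ : IsLInfty δ)
    (hx : IsCaratheodorySolution (closedLoop S V k μ ε Γ a β b C d θ δ) x₀ (Icc 0 T) x)
    {W : Vec n × Vec l × ℝ → ℝ} (hW : LocallyLipschitz W) {g : ℝ → ℝ}
    (h : ∀ s ∈ Ioo 0 T, HasDerivAt x (closedLoop S V k μ ε Γ a β b C d θ δ s (x s)) s →
      ‖d s‖ ≤ supNorm d → ‖θ s‖ ≤ supNorm θ → ‖δ s‖ ≤ supNorm δ →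
      ∃ D ≤ g s, HasDerivAt (fun t => W (x t)) D s) :
    DerivBound (fun t => W (x t)) g T := by
  intro t₁ t₂ c h₁ h₁₂ h₂ hg
  refine IsCaratheodorySolution.sub_le_of_ae_deriv_le (v := fun t => (d t, θ t, δ t))
    (hA.locallyLipschitz_closedLoopMap (ε := ε) (Γ := Γ) (a := a) (β := β) (b := b) (C := C))
    (ae_norm_inputs_le hd hθ hδ) hx hW h₁ h₁₂ h₂ ?_
  filter_upwards [hg, ae_inputs_le hd hθ hδ] with s hs hin hs' hder
  have h0s : 0 < s := h₁.trans_lt hs'.1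
  obtain ⟨hds, hθs, hδs⟩ := hin h0s.le
  obtain ⟨D, hD, hWD⟩ := h s ⟨h0s, hs'.2.trans_le h₂⟩ hder hds hθs hδs
  exact ⟨D, hD.trans (hs hs'), hWD⟩

lemma HasDerivAt.fst_snd {x : ℝ → Vec n × Vec l × ℝ} {v : Vec n × Vec l × ℝ} {s : ℝ}
    (h : HasDerivAt x v s) :
    HasDerivAt (fun t => (x t).1) v.1 s ∧ HasDerivAt (fun t => (x t).2.1) v.2.1 s ∧
      HasDerivAt (fun t => (x t).2.2) v.2.2 s := by
  have h2 : HasDerivAt (fun t => (x t).2) v.2 s :=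
    (hasFDerivAt_snd (𝕜 := ℝ) (p := x s)).comp_hasDerivAt s h
  have h3 : HasDerivAt (fun t => (x t).2.1) v.2.1 s :=
    HasFDerivAt.comp_hasDerivAt (f := fun t => (x t).2) s hasFDerivAt_fst h2
  have h4 : HasDerivAt (fun t => (x t).2.2) v.2.2 s :=
    HasFDerivAt.comp_hasDerivAt (f := fun t => (x t).2) s hasFDerivAt_snd h2
  exact ⟨(hasFDerivAt_fst (𝕜 := ℝ) (p := x s)).comp_hasDerivAt s h, h3, h4⟩

lemma IsSmoothProperPosDef.locallyLipschitz {j : ℕ} {V : Vec j → ℝ}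
    (hV : IsSmoothProperPosDef V) : LocallyLipschitz V :=
  (hV.smooth.of_le (by simp)).locallyLipschitz

lemma IsSmoothProperPosDef.hasDerivAt_comp {j : ℕ} {V : Vec j → ℝ}
    (hV : IsSmoothProperPosDef V) {y : ℝ → Vec j} {v : Vec j} {s : ℝ} (hy : HasDerivAt y v s) :
    HasDerivAt (fun t => V (y t)) (fderiv ℝ V (y s) v) s :=
  ((hV.smooth.differentiable (by simp)) (y s)).hasFDerivAt.comp_hasDerivAt s hy

lemma IsSmoothProperPosDef.nonneg {j : ℕ} {V : Vec j → ℝ}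
    (hV : IsSmoothProperPosDef V) (y : Vec j) : 0 ≤ V y := by
  rcases eq_or_ne y 0 with rfl | h
  · exact hV.map_zero.ge
  · exact (hV.pos y h).le

lemma IsSmoothProperPosDef.eq_zero {j : ℕ} {V : Vec j → ℝ}
    (hV : IsSmoothProperPosDef V) {y : Vec j} (h : V y = 0) : y = 0 := by
  by_contra hne
  exact absurd h (hV.pos y hne).ne'

/-- The derivative of `e^z` along the closed loop. -/
lemma hasDerivAt_exp_gain {s : ℝ}
    (h : HasDerivAt x (closedLoop S V k μ ε Γ a β b C d θ δ s (x s)) s) :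
    HasDerivAt (fun t => Real.exp (x t).2.2) (Γ * max (V (x s).1 - ε) 0) s := by
  have := (HasDerivAt.fst_snd h).2.2.exp
  convert this using 1
  simp only [closedLoop]
  have : Real.exp (x s).2.2 * Real.exp (-(x s).2.2) = 1 := by rw [← Real.exp_add]; simp
  linear_combination (-(Γ * max (V (x s).1 - ε) 0)) * this

/-- `DerivBound` transports upper bounds only; the minus sign turns it into a lower bound on the
growth of the gain. -/
lemma AssumptionA.derivBound_neg_exp_gain (hA : AssumptionA S V Q k Φ R μ r Λ γ)
    (hd : IsLInfty d) (hθ : IsLInfty θ) (hδ : IsLInfty δ)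
    (hx : IsCaratheodorySolution (closedLoop S V k μ ε Γ a β b C d θ δ) x₀ (Icc 0 T) x) :
    DerivBound (fun t => -Real.exp (x t).2.2) (fun s => -(Γ * max (V (x s).1 - ε) 0)) T := by
  have hW : LocallyLipschitz fun x : Vec n × Vec l × ℝ => -Real.exp x.2.2 := by
    have : ContDiff ℝ 1 fun x : Vec n × Vec l × ℝ => -Real.exp x.2.2 := by fun_prop
    exact this.locallyLipschitz
  exact hA.derivBound hd hθ hδ hx hW fun s _ h _ _ _ =>
    ⟨_, le_rfl, (hasDerivAt_exp_gain h).neg⟩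

/-- The dynamic gain is non-decreasing. -/
lemma AssumptionA.monotoneOn_gain (hA : AssumptionA S V Q k Φ R μ r Λ γ) (hΓ : 0 < Γ)
    (hd : IsLInfty d) (hθ : IsLInfty θ) (hδ : IsLInfty δ)
    (hx : IsCaratheodorySolution (closedLoop S V k μ ε Γ a β b C d θ δ) x₀ (Icc 0 T) x) :
    MonotoneOn (fun t => (x t).2.2) (Icc 0 T) := by
  have h := (hA.derivBound_neg_exp_gain hd hθ hδ hx).antitoneOn (by
    refine Eventually.of_forall fun s _ => ?_
    have : 0 ≤ Γ * max (V (x s).1 - ε) 0 := by positivity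
    linarith)
  intro s hs t ht hst
  have := h hs ht hst
  exact Real.exp_le_exp.1 (neg_le_neg_iff.1 this)

lemma IsCaratheodorySolution.apply_zero {E : Type*} [NormedAddCommGroup E] [NormedSpace ℝ E]
    {F : ℝ → E → E} {x₀ : E} {I : Set ℝ} {x : ℝ → E} (h : IsCaratheodorySolution F x₀ I x)
    (h0 : (0 : ℝ) ∈ I) : x 0 = x₀ := by
  simpa using h.eq_integral 0 h0

lemma AssumptionA.le_gain (hA : AssumptionA S V Q k Φ R μ r Λ γ) (hΓ : 0 < Γ)
    (hd : IsLInfty d) (hθ : IsLInfty θ) (hδ : IsLInfty δ)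
    (hx : IsCaratheodorySolution (closedLoop S V k μ ε Γ a β b C d θ δ) x₀ (Icc 0 T) x)
    {t : ℝ} (ht : t ∈ Icc 0 T) : x₀.2.2 ≤ (x t).2.2 := by
  have h0 : (0 : ℝ) ∈ Icc 0 T := ⟨le_rfl, ht.1.trans ht.2⟩
  have := hA.monotoneOn_gain hΓ hd hθ hδ hx h0 ht ht.1
  simpa [hx.apply_zero h0] using this

/-- The differential inequality for `Φ`. -/
lemma AssumptionA.derivBound_Φ (hA : AssumptionA S V Q k Φ R μ r Λ γ)
    (hd : IsLInfty d) (hθ : IsLInfty θ) (hδ : IsLInfty δ)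
    (hx : IsCaratheodorySolution (closedLoop S V k μ ε Γ a β b C d θ δ) x₀ (Icc 0 T) x) :
    DerivBound (fun t => Φ (x t).2.1)
      (fun s => -R (x s).2.1 + γ ‖δ s‖ + Q (x s).1) T := by
  have hW : LocallyLipschitz fun x : Vec n × Vec l × ℝ => Φ x.2.1 :=
    hA.Φ_prop.locallyLipschitz.comp
      (LipschitzWith.prod_fst.comp LipschitzWith.prod_snd).locallyLipschitz
  exact hA.derivBound hd hθ hδ hx hW fun s _ h _ _ _ =>
    ⟨_, hA.decrease_Φ _ _ _, hA.Φ_prop.hasDerivAt_comp (HasDerivAt.fst_snd h).2.1⟩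

/-- The differential inequality for `U`. -/
lemma AssumptionA.derivBound_lyapU (hA : AssumptionA S V Q k Φ R μ r Λ γ)
    (ha : 0 < a) (ha1 : a ≤ 1) (hβ : 0 < β) (hβ1 : β ≤ 1) (hb : 1 ≤ b) (hC : 1 ≤ C)
    (hd : IsLInfty d) (hθ : IsLInfty θ) (hδ : IsLInfty δ)
    (hx : IsCaratheodorySolution (closedLoop S V k μ ε Γ a β b C d θ δ) x₀ (Icc 0 T) x) :
    DerivBound (fun t => lyapU V Φ r (x t).1 (x t).2.1)
      (fun s => -((r / 2 - a * β / b) * (Q (x s).1 + R (x s).2.1))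
        + chi γ r Λ a β b ‖d s‖ ‖δ s‖ ‖θ s‖ (Real.exp (x s).2.2)) T := by
  have hW : LocallyLipschitz fun x : Vec n × Vec l × ℝ => lyapU V Φ r x.1 x.2.1 := by
    have : ContDiff ℝ ∞ fun x : Vec n × Vec l × ℝ => lyapU V Φ r x.1 x.2.1 :=
      (hA.V_prop.smooth.comp contDiff_fst).add
        (contDiff_const.mul (hA.Φ_prop.smooth.comp (contDiff_fst.comp contDiff_snd)))
    exact (this.of_le (by simp)).locallyLipschitz
  refine hA.derivBound hd hθ hδ hx hW fun s _ h _ _ _ => ?_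
  obtain ⟨hy, hw, -⟩ := HasDerivAt.fst_snd h
  refine ⟨_, ?_, (hA.V_prop.hasDerivAt_comp hy).add
    ((hA.Φ_prop.hasDerivAt_comp hw).const_mul (r / 2))⟩
  have h1 := hA.fderiv_V_closedLoop_le ha ha1 hβ hβ1 hb hC (x s).1 (x s).2.1 (x s).2.2 (θ s) (d s)
  have h2 := hA.decrease_Φ (x s).1 (x s).2.1 (δ s)
  -- The weight r/2 spends half of -rQ on the Q in the inequality for Φ, leaving -(r/2)(Q + R).
  have h2' := mul_le_mul_of_nonneg_left h2 (by linarith [hA.r_pos] : 0 ≤ r / 2)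
  have hE := Real.exp_pos (x s).2.2
  have hQR : 0 ≤ Q (x s).1 + R (x s).2.1 := add_nonneg (hA.Q_prop.nonneg _) (hA.R_prop.nonneg _)
  have h3 : a * β / (b + Real.exp (x s).2.2) * (Q (x s).1 + R (x s).2.1)
      ≤ a * β / b * (Q (x s).1 + R (x s).2.1) := by
    have : a * β / (b + Real.exp (x s).2.2) ≤ a * β / b :=
      div_le_div_of_nonneg_left (by positivity) (by linarith) (by linarith)
    gcongr
  have h4 : chi γ r Λ a β b ‖d s‖ ‖δ s‖ ‖θ s‖ (Real.exp (x s).2.2)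
      = r / 2 * γ ‖δ s‖ + a * β / (b + Real.exp (x s).2.2) * (2 * Λ)
        + a * (((max (‖θ s‖ - b - Real.exp (x s).2.2) 0) ^ 2
        + (max (‖θ s‖ - b - Real.exp (x s).2.2) 0) ^ 4
        + ‖d s‖ ^ 2 + ‖d s‖ ^ 4) / (b + Real.exp (x s).2.2)) := by
    simp only [chi]; ring
  change fderiv ℝ V (x s).1 (S.f (x s).1 + (control S V k μ a β b C (x s).1 (x s).2.2
      + inner ℝ (S.φ (x s).1 (x s).2.1) (θ s) + inner ℝ (S.A (x s).1 (x s).2.1) (d s))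
      • S.g (x s).1) + r / 2 * fderiv ℝ Φ (x s).2.1 (S.h (x s).1 (x s).2.1 (δ s)) ≤ _
  rw [h4]
  linarith

/-- A larger gain makes χ smaller, so along a solution the initial gain and the input norms give an
upper bound. -/
lemma chi_mono (hγ : IsGainFunction γ) (hr : 0 < r) (hΛ : 0 ≤ Λ) (ha : 0 < a) (hβ : 0 < β)
    (hb : 1 ≤ b) {s₁ s₂ s₃ s₄ t₁ t₂ t₃ t₄ : ℝ} (h1 : 0 ≤ s₁) (h2 : 0 ≤ s₂) (h4 : 0 < t₄)
    (h1' : s₁ ≤ t₁) (h2' : s₂ ≤ t₂) (h3' : s₃ ≤ t₃) (h4' : t₄ ≤ s₄) :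
    chi γ r Λ a β b s₁ s₂ s₃ s₄ ≤ chi γ r Λ a β b t₁ t₂ t₃ t₄ := by
  have hγ' := hγ.monotoneOn (mem_Ici.2 h2) (mem_Ici.2 (h2.trans h2')) h2'
  unfold chi
  gcongr

lemma chi_nonneg (hγ : IsGainFunction γ) (hr : 0 < r) (hΛ : 0 ≤ Λ) (ha : 0 < a) (hβ : 0 < β)
    (hb : 1 ≤ b) {s₁ s₂ s₃ s₄ : ℝ} (h2 : 0 ≤ s₂) (h4 : 0 < s₄) :
    0 ≤ chi γ r Λ a β b s₁ s₂ s₃ s₄ := by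
  have hγ' := hγ.nonneg s₂ h2
  unfold chi
  positivity

/-- The input-to-output stability estimate for `U` in terms of a comparison function. -/
lemma AssumptionA.lyapU_le (hA : AssumptionA S V Q k Φ R μ r Λ γ) (hΓ : 0 < Γ)
    (ha : 0 < a) (ha1 : a ≤ 1) (hβ : 0 < β) (hβ1 : β ≤ 1) (hb : 1 ≤ b) (hC : 1 ≤ C)
    {σ : ℝ ≃o ℝ} (hσ0 : σ 0 = 0)
    (hσ : ∀ y w, lyapU V Φ r y w ≤ σ ((r / 2 - a * β / b) / 2 * (Q y + R w)))
    (hd : IsLInfty d) (hθ : IsLInfty θ) (hδ : IsLInfty δ)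
    (hx : IsCaratheodorySolution (closedLoop S V k μ ε Γ a β b C d θ δ) x₀ (Icc 0 T) x)
    {t : ℝ} (ht : t ∈ Icc 0 T) :
    lyapU V Φ r (x t).1 (x t).2.1 ≤ decayKL σ.symm (lyapU V Φ r x₀.1 x₀.2.1) t
      + σ (chi γ r Λ a β b (supNorm d) (supNorm δ) (supNorm θ) (Real.exp x₀.2.2)) := by
  set χ₀ := chi γ r Λ a β b (supNorm d) (supNorm δ) (supNorm θ) (Real.exp x₀.2.2) with hχ
  have hχ0 : 0 ≤ χ₀ := chi_nonneg hA.γ_prop hA.r_pos hA.Λ_nonneg ha hβ hb (supNorm_nonneg _)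
    (Real.exp_pos _)
  have hU0 : ∀ y w, 0 ≤ lyapU V Φ r y w := fun y w => by
    have := hA.V_prop.nonneg y
    have := hA.Φ_prop.nonneg w
    have := hA.r_pos
    unfold lyapU
    positivity
  have hσs := OrderIso.symm_apply_zero_of_apply_zero hσ0
  have hl : 0 ≤ σ χ₀ := OrderIso.map_nonneg_of_apply_zero hσ0 hχ0
  have hUc : ContinuousOn (fun t => lyapU V Φ r (x t).1 (x t).2.1) (Icc 0 T) := by
    have : Continuous fun u : Vec n × Vec l × ℝ => lyapU V Φ r u.1 u.2.1 :=
      (hA.V_prop.smooth.continuous.comp continuous_fst).add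
        (continuous_const.mul (hA.Φ_prop.smooth.continuous.comp
          (continuous_fst.comp continuous_snd)))
    exact this.comp_continuousOn hx.continuousOn
  -- σ is tuned to half the decay rate, so the full rate yields 2σ⁻¹(U). Above the level σ(χ₀), one
  -- copy of σ⁻¹(U) cancels χ₀ and the other remains as decay.
  have hdec := (hA.derivBound_lyapU ha ha1 hβ hβ1 hb hC hd hθ hδ hx).le_or_decay hUc
    hσs hl (by
      filter_upwards [ae_inputs_le hd hθ hδ] with s hin hs hlt
      obtain ⟨hds, hθs, hδs⟩ := hin hs.1.le
      have h1 : chi γ r Λ a β b ‖d s‖ ‖δ s‖ ‖θ s‖ (Real.exp (x s).2.2) ≤ χ₀ :=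
        chi_mono hA.γ_prop hA.r_pos hA.Λ_nonneg ha hβ hb (norm_nonneg _) (norm_nonneg _)
          (Real.exp_pos _) hds hδs hθs
          (Real.exp_le_exp.2 (hA.le_gain hΓ hd hθ hδ hx (Ioo_subset_Icc_self hs)))
      have h2 : σ.symm (lyapU V Φ r (x s).1 (x s).2.1)
          ≤ (r / 2 - a * β / b) / 2 * (Q (x s).1 + R (x s).2.1) := by
        rw [OrderIso.symm_apply_le]; exact hσ _ _
      have h3 : χ₀ < σ.symm (lyapU V Φ r (x s).1 (x s).2.1) := by
        rwa [OrderIso.lt_symm_apply]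
      linarith) ht
  have hk0 : 0 ≤ decayKL σ.symm (lyapU V Φ r x₀.1 x₀.2.1) t :=
    decayKL_nonneg hσs (hU0 _ _) ht.1
  rcases hdec with h | ⟨h0, h⟩
  · linarith
  · rw [hx.apply_zero ⟨le_rfl, ht.1.trans ht.2⟩] at h
    linarith [le_decayKL ht.1 h0 hσs h]

/-! ### Boundedness of the dynamic gain. -/

/-- Squaring removes the kink of the positive part at 0, so `gainLyap` can be differentiated along a
solution also when V = ε. -/
lemma hasDerivAt_max_sq_div_two (v : ℝ) :
    HasDerivAt (fun v : ℝ => max v 0 ^ 2 / 2) (max v 0) v := by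
  rcases lt_trichotomy v 0 with h | rfl | h
  · rw [max_eq_right h.le]
    refine (hasDerivAt_const v (0 : ℝ)).congr_of_eventuallyEq ?_
    filter_upwards [gt_mem_nhds h] with u hu
    simp [max_eq_right hu.le]
  · rw [max_self, hasDerivAt_iff_isLittleO_nhds_zero]
    simp only [zero_add, max_self, smul_zero, sub_zero]
    refine (Asymptotics.IsBigO.of_bound 1 (Eventually.of_forall fun h => ?_)).trans_isLittleO
      (Asymptotics.isLittleO_pow_id (𝕜 := ℝ) one_lt_two)
    simp only [Real.norm_eq_abs, abs_pow, sq_abs, one_mul]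
    have : |max h 0| ≤ |h| := by
      rw [abs_of_nonneg (le_max_right _ _)]; exact max_le (le_abs_self h) (abs_nonneg h)
    have h2 := sq_le_sq.2 this
    have h3 := sq_nonneg (max h 0)
    norm_num
    rw [abs_of_nonneg (by positivity)]
    linarith
  · rw [max_eq_left h.le]
    have := ((hasDerivAt_id v).pow 2).div_const 2
    simp only [id, Nat.cast_ofNat] at this
    refine (this.congr_deriv (by ring)).congr_of_eventuallyEq ?_
    filter_upwards [lt_mem_nhds h] with u hu
    simp [max_eq_left hu.le]

/-- The function whose decrease bounds the dynamic gain. -/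
noncomputable def gainLyap (V : Vec n → ℝ) (ε Γ b P M : ℝ) (x : Vec n × Vec l × ℝ) : ℝ :=
  max (V x.1 - ε) 0 ^ 2 / 2 + (P / Γ * Real.exp x.2.2 - M / Γ * Real.log (b + Real.exp x.2.2))

/-- `gainLyap` is non-increasing along solutions on which the perturbation is bounded by `M`. -/
lemma AssumptionA.antitoneOn_gainLyap (hA : AssumptionA S V Q k Φ R μ r Λ γ) (hΓ : 0 < Γ)
    (ha : 0 < a) (ha1 : a ≤ 1) (hβ : 0 < β) (hβ1 : β ≤ 1) (hb : 1 ≤ b) (hC : 1 ≤ C)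
    (hd : IsLInfty d) (hθ : IsLInfty θ) (hδ : IsLInfty δ)
    (hx : IsCaratheodorySolution (closedLoop S V k μ ε Γ a β b C d θ δ) x₀ (Icc 0 T) x)
    {P M Rb : ℝ} (hP : ∀ y, ε ≤ V y → P ≤ (r - a * β / b) * Q y)
    (hR : ∀ t ∈ Icc 0 T, R (x t).2.1 ≤ Rb)
    (hM : a * β * (Rb + 2 * Λ) + a * (supNorm θ ^ 2 + supNorm θ ^ 4 + supNorm d ^ 2
      + supNorm d ^ 4) ≤ M) :
    AntitoneOn (fun t => gainLyap V ε Γ b P M (x t)) (Icc 0 T) := by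
  have hbE : ∀ z, 0 < b + Real.exp z := fun z => by have := Real.exp_pos z; linarith
  have hW : LocallyLipschitz (gainLyap V ε Γ b P M : Vec n × Vec l × ℝ → ℝ) := by
    have i1 : LocallyLipschitz fun x : Vec n × Vec l × ℝ => (max (V x.1 - ε) 0, x.2.2) := by
      refine LocallyLipschitz.prodMk ?_
        (LipschitzWith.prod_snd.comp LipschitzWith.prod_snd).locallyLipschitz
      have : ContDiff ℝ ∞ fun x : Vec n × Vec l × ℝ => V x.1 - ε :=
        (hA.V_prop.smooth.comp contDiff_fst).sub contDiff_const
      exact (this.of_le (by simp)).locallyLipschitz.max_const 0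
    set F : ℝ × ℝ → ℝ := fun u => u.1 ^ 2 / 2
      + (P / Γ * Real.exp u.2 - M / Γ * Real.log (b + Real.exp u.2)) with hF
    have i2 : ContDiff ℝ 1 F := by
      have i3 : ContDiff ℝ 1 fun u : ℝ × ℝ => Real.log (b + Real.exp u.2) :=
        ContDiff.log (by fun_prop) fun u => (hbE u.2).ne'
      fun_prop
    have i4 := i2.locallyLipschitz.comp i1
    have i5 : (gainLyap V ε Γ b P M : Vec n × Vec l × ℝ → ℝ)
        = F ∘ fun x => (max (V x.1 - ε) 0, x.2.2) := by
      funext x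
      simp only [gainLyap, hF, Function.comp]
    rw [i5]
    exact i4
  refine DerivBound.antitoneOn (g := fun _ => 0)
    (hA.derivBound hd hθ hδ hx hW fun s hs h hds hθs hδs => ?_) (by simp)
  obtain ⟨hy, -, -⟩ := HasDerivAt.fst_snd h
  have hV := hA.V_prop.hasDerivAt_comp hy
  have hE := hasDerivAt_exp_gain h
  have hPd := (hasDerivAt_max_sq_div_two (V (x s).1 - ε)).comp s (hV.sub_const ε)
  have hlog := (hE.const_add b).log (hbE _).ne'
  refine ⟨_, ?_, hPd.add ((hE.const_mul (P / Γ)).sub (hlog.const_mul (M / Γ)))⟩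
  set c := b + Real.exp (x s).2.2 with hc
  have hc0 : 0 < c := hbE _
  set mm := max (V (x s).1 - ε) 0 with hmm
  have hm0 : 0 ≤ mm := le_max_right _ _
  have hder := hA.fderiv_V_closedLoop_le ha ha1 hβ hβ1 hb hC (x s).1 (x s).2.1 (x s).2.2 (θ s) (d s)
  change fderiv ℝ V (x s).1 (closedLoop S V k μ ε Γ a β b C d θ δ s (x s)).1 ≤ _ at hder
  set D := fderiv ℝ V (x s).1 (closedLoop S V k μ ε Γ a β b C d θ δ s (x s)).1
  -- The coefficients P/Γ and M/Γ are chosen so that the derivative has the common factor (V - ε)^+,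
  -- which comes from (e^z)'. Only points with V > ε then matter.
  have hval : mm * D + (P / Γ * (Γ * mm) - M / Γ * (Γ * mm / c)) = mm * (D + P - M / c) := by
    field_simp
    ring
  rw [hval]
  rcases le_or_gt (V (x s).1 - ε) 0 with hle | hgt
  · rw [hmm, max_eq_right hle, zero_mul]
  refine mul_nonpos_of_nonneg_of_nonpos hm0 ?_
  have hPs := hP (x s).1 (by linarith)
  have hQ := hA.Q_prop.nonneg (x s).1
  have hQc : a * β / c * Q (x s).1 ≤ a * β / b * Q (x s).1 := by
    have : a * β / c ≤ a * β / b :=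
      div_le_div_of_nonneg_left (by positivity) (by linarith)
        (by have := Real.exp_pos (x s).2.2; linarith)
    gcongr
  have hmax : max (‖θ s‖ - b - Real.exp (x s).2.2) 0 ≤ supNorm θ := by
    refine max_le ?_ (supNorm_nonneg _)
    have := Real.exp_pos (x s).2.2
    linarith
  have hmax0 : 0 ≤ max (‖θ s‖ - b - Real.exp (x s).2.2) 0 := le_max_right _ _
  have hpert : a * β / c * (R (x s).2.1 + 2 * Λ)
      + a * (((max (‖θ s‖ - b - Real.exp (x s).2.2) 0) ^ 2
        + (max (‖θ s‖ - b - Real.exp (x s).2.2) 0) ^ 4 + ‖d s‖ ^ 2 + ‖d s‖ ^ 4) / c) ≤ M / c := by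
    have e1 : a * β / c * (R (x s).2.1 + 2 * Λ)
      + a * (((max (‖θ s‖ - b - Real.exp (x s).2.2) 0) ^ 2
        + (max (‖θ s‖ - b - Real.exp (x s).2.2) 0) ^ 4 + ‖d s‖ ^ 2 + ‖d s‖ ^ 4) / c)
      = (a * β * (R (x s).2.1 + 2 * Λ)
      + a * ((max (‖θ s‖ - b - Real.exp (x s).2.2) 0) ^ 2
        + (max (‖θ s‖ - b - Real.exp (x s).2.2) 0) ^ 4 + ‖d s‖ ^ 2 + ‖d s‖ ^ 4)) / c := by
      field_simp
    rw [e1]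
    refine div_le_div_of_nonneg_right (le_trans ?_ hM) hc0.le
    have := hR s (Ioo_subset_Icc_self hs)
    gcongr
  linarith

/-- The explicit bound on `e^z` obtained from the decrease of `gainLyap`. -/
noncomputable def gainBound (Γ b P M E₀ p₀ : ℝ) : ℝ :=
  2 * E₀ + b + 2 / P * (2 * M ^ 2 / P + Γ * p₀)

/-- From log u ≤ 2√u and Young with weight P/2, the logarithm costs at most half of the linear term.
The initial logarithm is dropped, being nonnegative because b ≥ 1. -/
lemma exp_le_gainBound {Γ b P M E E₀ p p₀ : ℝ} (hΓ : 0 < Γ) (hb : 1 ≤ b) (hP : 0 < P)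
    (hM : 0 ≤ M) (hE : 0 < E) (hE₀ : 0 < E₀) (hp : 0 ≤ p)
    (h : p + (P / Γ * E - M / Γ * Real.log (b + E))
      ≤ p₀ + (P / Γ * E₀ - M / Γ * Real.log (b + E₀))) :
    E ≤ gainBound Γ b P M E₀ p₀ := by
  have hlog0 : 0 ≤ Real.log (b + E₀) := Real.log_nonneg (by linarith)
  have hpos : 0 < b + E := by linarith
  have hsq : Real.sqrt (b + E) ^ 2 = b + E := Real.sq_sqrt hpos.le
  have hlog : Real.log (b + E) ≤ 2 * Real.sqrt (b + E) := by
    have h1 := Real.log_le_sub_one_of_pos (Real.sqrt_pos.2 hpos)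
    rw [Real.log_sqrt hpos.le] at h1
    linarith
  have h1 : P * E - M * Real.log (b + E) ≤ Γ * p₀ + P * E₀ := by
    have h2 := mul_le_mul_of_nonneg_left h hΓ.le
    have e1 : Γ * (p + (P / Γ * E - M / Γ * Real.log (b + E)))
      = Γ * p + (P * E - M * Real.log (b + E)) := by field_simp
    have e2 : Γ * (p₀ + (P / Γ * E₀ - M / Γ * Real.log (b + E₀)))
      = Γ * p₀ + (P * E₀ - M * Real.log (b + E₀)) := by field_simp
    have : 0 ≤ Γ * p := by positivity
    have : 0 ≤ M * Real.log (b + E₀) := by positivity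
    linarith
  have h2 : M * Real.log (b + E) ≤ P / 2 * (b + E) + 2 * M ^ 2 / P := by
    have h3 : M * Real.log (b + E) ≤ M * (2 * Real.sqrt (b + E)) := by gcongr
    have h4 := mul_le_add_sq_div (p := Real.sqrt (b + E)) (q := 2 * M) (k := P / 2) (by positivity)
    have e : (2 * M) ^ 2 / (4 * (P / 2)) = 2 * M ^ 2 / P := by field_simp; ring
    rw [hsq, e] at h4
    linarith
  have h3 : P / 2 * E ≤ P / 2 * gainBound Γ b P M E₀ p₀ := by
    have e : P / 2 * gainBound Γ b P M E₀ p₀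
        = P * E₀ + P / 2 * b + (2 * M ^ 2 / P + Γ * p₀) := by
      unfold gainBound
      field_simp
    rw [e]
    linarith
  exact le_of_mul_le_mul_left h3 (by positivity)

end System

/-! ### A priori bounds, global existence and convergence of the measured state. -/

section System

variable {n l m p q : ℕ} {S : Plant n l m p q} {V Q k : Vec n → ℝ} {Φ R : Vec l → ℝ}
  {μ : Vec n → ℝ} {r Λ : ℝ} {γ : ℝ → ℝ} {ε Γ a β b C : ℝ}
  {d : ℝ → Vec m} {θ : ℝ → Vec p} {δ : ℝ → Vec q} {x₀ : Vec n × Vec l × ℝ} {T : ℝ}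
  {x : ℝ → Vec n × Vec l × ℝ}

/-- A bound on `U` in terms of the initial state and of the norms of the inputs `d, δ, θ`. -/
noncomputable def stateBound (V : Vec n → ℝ) (Φ : Vec l → ℝ) (γ : ℝ → ℝ) (r Λ a β b : ℝ)
    (σ : ℝ ≃o ℝ) (X : (Vec n × Vec l × ℝ) × (ℝ × ℝ × ℝ)) : ℝ :=
  decayKL σ.symm (lyapU V Φ r X.1.1 X.1.2.1) 0
    + σ (chi γ r Λ a β b (max X.2.1 0) (max X.2.2.1 0) (max X.2.2.2 0) (Real.exp X.1.2.2))

/-- A bound on the perturbation in the differential inequality for `V`. -/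
noncomputable def perturbationBound (V : Vec n → ℝ) (Φ : Vec l → ℝ) (γ : ℝ → ℝ) (r Λ a β b : ℝ)
    (σ σR : ℝ ≃o ℝ) (X : (Vec n × Vec l × ℝ) × (ℝ × ℝ × ℝ)) : ℝ :=
  a * β * (σR (2 / r * stateBound V Φ γ r Λ a β b σ X) + 2 * Λ)
    + a * (max X.2.2.2 0 ^ 2 + max X.2.2.2 0 ^ 4 + max X.2.1 0 ^ 2 + max X.2.1 0 ^ 4)

/-- The bound for the limit of the dynamic gain. -/
noncomputable def gainLimitBound (V : Vec n → ℝ) (Φ : Vec l → ℝ) (γ : ℝ → ℝ)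
    (r Λ ε Γ a β b : ℝ) (σ σR : ℝ ≃o ℝ) (P : ℝ) (X : (Vec n × Vec l × ℝ) × (ℝ × ℝ × ℝ)) : ℝ :=
  Real.log (gainBound Γ b P (perturbationBound V Φ γ r Λ a β b σ σR X) (Real.exp X.1.2.2)
    (max (V X.1.1 - ε) 0 ^ 2 / 2))

lemma gainBound_pos {Γ b P M E₀ p₀ : ℝ} (hΓ : 0 < Γ) (hb : 1 ≤ b) (hP : 0 < P) (hE₀ : 0 < E₀)
    (hp₀ : 0 ≤ p₀) : 0 < gainBound Γ b P M E₀ p₀ := by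
  unfold gainBound
  positivity

lemma AssumptionA.lyapU_nonneg (hA : AssumptionA S V Q k Φ R μ r Λ γ) (y : Vec n) (w : Vec l) :
    0 ≤ lyapU V Φ r y w := by
  have := hA.V_prop.nonneg y
  have := hA.Φ_prop.nonneg w
  have := hA.r_pos
  unfold lyapU
  positivity

lemma AssumptionA.continuous_lyapU (hA : AssumptionA S V Q k Φ R μ r Λ γ) :
    Continuous fun u : Vec n × Vec l => lyapU V Φ r u.1 u.2 :=
  (hA.V_prop.smooth.continuous.comp continuous_fst).add
    (continuous_const.mul (hA.Φ_prop.smooth.continuous.comp continuous_snd))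

/-- The cut-offs at 0 in the input arguments give continuity on the whole space, although γ is
controlled only on [0, ∞). -/
lemma AssumptionA.continuous_stateBound (hA : AssumptionA S V Q k Φ R μ r Λ γ) (hb : 1 ≤ b)
    (σ : ℝ ≃o ℝ) : Continuous (stateBound V Φ γ r Λ a β b σ) := by
  let X := (Vec n × Vec l × ℝ) × (ℝ × ℝ × ℝ)
  have hγ : Continuous fun X : X => γ (max X.2.2.1 0) :=
    hA.γ_prop.continuousOn.comp_continuous (by fun_prop) fun X => mem_Ici.2 (le_max_right _ _)
  have hU : Continuous fun X : X => lyapU V Φ r X.1.1 X.1.2.1 :=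
    hA.continuous_lyapU.comp
      (by fun_prop : Continuous fun X : X => (X.1.1, X.1.2.1))
  have hs := σ.symm.continuous
  have hc := σ.continuous
  unfold stateBound decayKL chi
  refine Continuous.add (hc.comp ?_) (hc.comp ?_)
  · exact ((hs.comp hU).add hU).div_const _
  · refine (continuous_const.mul hγ).add (continuous_const.mul (Continuous.div ?_ ?_ ?_))
    · fun_prop
    · fun_prop
    · intro X
      have := Real.exp_pos X.1.2.2
      positivity

lemma AssumptionA.continuous_gainLimitBound (hA : AssumptionA S V Q k Φ R μ r Λ γ) (hb : 1 ≤ b)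
    (hΓ : 0 < Γ) (σ σR : ℝ ≃o ℝ) {P : ℝ} (hP : 0 < P) :
    Continuous (gainLimitBound V Φ γ r Λ ε Γ a β b σ σR P) := by
  have h1 : Continuous (perturbationBound V Φ γ r Λ a β b σ σR) := by
    have := hA.continuous_stateBound (a := a) (β := β) hb σ
    have := σR.continuous
    unfold perturbationBound
    fun_prop
  have hV : Continuous fun X : (Vec n × Vec l × ℝ) × (ℝ × ℝ × ℝ) => V X.1.1 :=
    hA.V_prop.smooth.continuous.comp (by fun_prop)
  refine Continuous.log ?_ fun X => (gainBound_pos hΓ hb hP (Real.exp_pos _) (by positivity)).ne'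
  unfold gainBound
  have h2 : Continuous fun X : (Vec n × Vec l × ℝ) × (ℝ × ℝ × ℝ) => max (V X.1.1 - ε) 0 ^ 2 / 2 :=
    (((hV.sub continuous_const).max continuous_const).pow 2).div_const 2
  exact Continuous.add (by fun_prop) (continuous_const.mul
    (((continuous_const.mul (h1.pow 2)).div_const P).add (continuous_const.mul h2)))

/-- The first rate is that of U, the second that of V alone; the condition 2aβ < br enters the proof
only here. -/
lemma AssumptionA.rate_pos (hA : AssumptionA S V Q k Φ R μ r Λ γ) (hb : 1 ≤ b)
    (hab : 2 * a * β < b * r) : 0 < r / 2 - a * β / b ∧ 0 < r - a * β / b := by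
  have hb0 : 0 < b := by linarith
  have : a * β / b < r / 2 := by rw [div_lt_div_iff₀ hb0 two_pos]; linarith
  exact ⟨by linarith, by linarith [hA.r_pos]⟩

/-- A priori bounds for solutions of the closed loop. -/
lemma AssumptionA.apriori_bounds (hA : AssumptionA S V Q k Φ R μ r Λ γ) (hΓ : 0 < Γ)
    (ha : 0 < a) (ha1 : a ≤ 1) (hβ : 0 < β) (hβ1 : β ≤ 1) (hb : 1 ≤ b) (hC : 1 ≤ C)
    {σ σR : ℝ ≃o ℝ} (hσ0 : σ 0 = 0) (hσR0 : σR 0 = 0)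
    (hσ : ∀ y w, lyapU V Φ r y w ≤ σ ((r / 2 - a * β / b) / 2 * (Q y + R w)))
    (hσR : ∀ w, R w ≤ σR (Φ w)) {P : ℝ} (hP0 : 0 < P)
    (hP : ∀ y, ε ≤ V y → P ≤ (r - a * β / b) * Q y)
    (hd : IsLInfty d) (hθ : IsLInfty θ) (hδ : IsLInfty δ)
    (hx : IsCaratheodorySolution (closedLoop S V k μ ε Γ a β b C d θ δ) x₀ (Icc 0 T) x) :
    (∀ t ∈ Icc 0 T, lyapU V Φ r (x t).1 (x t).2.1
      ≤ stateBound V Φ γ r Λ a β b σ (x₀, (supNorm d, supNorm δ, supNorm θ))) ∧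
    AntitoneOn (fun t => gainLyap V ε Γ b P (perturbationBound V Φ γ r Λ a β b σ σR
      (x₀, (supNorm d, supNorm δ, supNorm θ))) (x t)) (Icc 0 T) ∧
    ∀ t ∈ Icc 0 T, (x t).2.2
      ≤ gainLimitBound V Φ γ r Λ ε Γ a β b σ σR P (x₀, (supNorm d, supNorm δ, supNorm θ)) := by
  have hσs := OrderIso.symm_apply_zero_of_apply_zero hσ0
  have hr := hA.r_pos
  have hU : ∀ t ∈ Icc 0 T, lyapU V Φ r (x t).1 (x t).2.1
      ≤ stateBound V Φ γ r Λ a β b σ (x₀, (supNorm d, supNorm δ, supNorm θ)) := by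
    intro t ht
    refine (hA.lyapU_le hΓ ha ha1 hβ hβ1 hb hC hσ0 hσ hd hθ hδ hx ht).trans ?_
    simp only [stateBound, max_eq_left (supNorm_nonneg _)]
    gcongr
    exact (isClassKL_decayKL hσs).antitoneOn _ (hA.lyapU_nonneg _ _) self_mem_Ici ht.1 ht.1
  set Ub := stateBound V Φ γ r Λ a β b σ (x₀, (supNorm d, supNorm δ, supNorm θ)) with hUb
  set M := perturbationBound V Φ γ r Λ a β b σ σR (x₀, (supNorm d, supNorm δ, supNorm θ)) with hM
  -- There is no circularity: the bound on U uses only the monotonicity of the gain, and through Φ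
  -- and R it then supplies the constant M needed to bound the gain.
  have hΦ : ∀ t ∈ Icc 0 T, Φ (x t).2.1 ≤ 2 / r * Ub := by
    intro t ht
    have h1 := hU t ht
    have h2 := hA.V_prop.nonneg (x t).1
    unfold lyapU at h1
    rw [div_mul_eq_mul_div, le_div_iff₀ hr]
    linarith
  have hanti := hA.antitoneOn_gainLyap hΓ ha ha1 hβ hβ1 hb hC hd hθ hδ hx (P := P) (M := M)
    (Rb := σR (2 / r * Ub)) hP
    (fun t ht => (hσR _).trans (σR.monotone (hΦ t ht)))
    (by simp only [hM, perturbationBound, max_eq_left (supNorm_nonneg _), ← hUb]; exact le_rfl)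
  refine ⟨hU, hanti, fun t ht => ?_⟩
  have h0 : (0 : ℝ) ∈ Icc 0 T := ⟨le_rfl, ht.1.trans ht.2⟩
  have hUb0 : 0 ≤ Ub := (hA.lyapU_nonneg _ _).trans (hU 0 h0)
  have hM0 : 0 ≤ M := by
    have h1 : 0 ≤ σR (2 / r * Ub) := OrderIso.map_nonneg_of_apply_zero hσR0 (by positivity)
    have h2 := hA.Λ_nonneg
    simp only [hM, perturbationBound, ← hUb]
    positivity
  have h1 := hanti h0 ht ht.1
  simp only [gainLyap, hx.apply_zero h0] at h1
  rw [gainLimitBound, Real.le_log_iff_exp_le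
    (gainBound_pos hΓ hb hP0 (Real.exp_pos _) (by positivity))]
  exact exp_le_gainBound hΓ hb hP0 hM0 (Real.exp_pos _) (Real.exp_pos _) (by positivity) h1

/-- Global existence for the closed loop. -/
lemma AssumptionA.exists_solution (hA : AssumptionA S V Q k Φ R μ r Λ γ) (hΓ : 0 < Γ)
    (hd : IsLInfty d) (hθ : IsLInfty θ) (hδ : IsLInfty δ) {Ub B : ℝ}
    (hap : ∀ T x, IsCaratheodorySolution (closedLoop S V k μ ε Γ a β b C d θ δ) x₀ (Icc 0 T) x →
      ∀ t ∈ Icc 0 T, lyapU V Φ r (x t).1 (x t).2.1 ≤ Ub ∧ (x t).2.2 ≤ B) :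
    ∃ x, IsCaratheodorySolution (closedLoop S V k μ ε Γ a β b C d θ δ) x₀ (Ici 0) x := by
  have hr := hA.r_pos
  have hK : IsCompact ({y | V y ≤ max Ub 1} ×ˢ ({w | Φ w ≤ 2 / r * max Ub 1} ×ˢ Icc x₀.2.2 B)) :=
    (hA.V_prop.radiallyUnbounded _ (by positivity)).prod
      ((hA.Φ_prop.radiallyUnbounded _ (by positivity)).prod isCompact_Icc)
  obtain ⟨ρ, hρ⟩ := hK.isBounded.exists_norm_le
  refine exists_solution_of_apriori_bound (v := fun t => (d t, θ t, δ t))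
    (hA.locallyLipschitz_closedLoopMap (ε := ε) (Γ := Γ) (a := a) (β := β) (b := b) (C := C))
    (hd.1.prodMk (hθ.1.prodMk hδ.1)) (ae_norm_inputs_le hd hθ hδ) (ρ := ρ + 1) ?_
  intro T x hT hx
  have hTm : T ∈ Icc 0 T := ⟨hT, le_rfl⟩
  obtain ⟨h1, h2⟩ := hap T x hx T hTm
  have h3 := hA.le_gain hΓ hd hθ hδ hx hTm
  have hV := hA.V_prop.nonneg (x T).1
  have hΦ := hA.Φ_prop.nonneg (x T).2.1
  have h4 := h1.trans (le_max_left Ub 1)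
  unfold lyapU at h4
  have h5 : 0 ≤ r / 2 * Φ (x T).2.1 := by positivity
  have hmem : x T ∈ ({y | V y ≤ max Ub 1} ×ˢ ({w | Φ w ≤ 2 / r * max Ub 1} ×ˢ Icc x₀.2.2 B)) := by
    refine ⟨mem_ofPred.2 (by linarith), mem_ofPred.2 ?_, h3, h2⟩
    rw [div_mul_eq_mul_div, le_div_iff₀ hr]
    linarith
  linarith [hρ _ hmem]

/-- The state estimate `limsup V ≤ ε`, in terms of eventual bounds. -/
lemma AssumptionA.eventually_V_le (hA : AssumptionA S V Q k Φ R μ r Λ γ) (hΓ : 0 < Γ)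
    (hb : 1 ≤ b) (hd : IsLInfty d) (hθ : IsLInfty θ) (hδ : IsLInfty δ)
    (hx : IsCaratheodorySolution (closedLoop S V k μ ε Γ a β b C d θ δ) x₀ (Ici 0) x)
    {P M zlim : ℝ} (hanti : AntitoneOn (fun t => gainLyap V ε Γ b P M (x t)) (Ici 0))
    (hz : Tendsto (fun t => (x t).2.2) atTop (𝓝 zlim))
    (hzle : ∀ t, 0 ≤ t → (x t).2.2 ≤ zlim) {η : ℝ} (hη : 0 < η) :
    ∀ᶠ t in atTop, V (x t).1 ≤ ε + η := by
  have hbE : ∀ z, 0 < b + Real.exp z := fun z => by have := Real.exp_pos z; linarith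
  set φ : ℝ → ℝ := fun z => P / Γ * Real.exp z - M / Γ * Real.log (b + Real.exp z) with hφ
  have hφc : Continuous φ := by
    have : Continuous fun z => Real.log (b + Real.exp z) :=
      Continuous.log (by fun_prop) fun z => (hbE z).ne'
    fun_prop
  have hφl := (hφc.tendsto zlim).comp hz
  set pot : ℝ → ℝ := fun t => max (V (x t).1 - ε) 0 ^ 2 / 2 with hpot
  have hN : Antitone fun t => gainLyap V ε Γ b P M (x (max t 0)) := fun s t hst =>
    hanti (mem_Ici.2 (le_max_right _ _)) (mem_Ici.2 (le_max_right _ _)) (max_le_max_right 0 hst)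
  have hNe : (fun t => gainLyap V ε Γ b P M (x (max t 0)) - φ (x t).2.2) =ᶠ[atTop] pot := by
    filter_upwards [eventually_ge_atTop 0] with t ht
    simp [max_eq_left ht, gainLyap, hφ, hpot]
  -- `pot` is a non-increasing function minus a convergent one; nonnegativity rules out the limit
  -- -∞.
  obtain ⟨pl, hp⟩ : ∃ pl, Tendsto pot atTop (𝓝 pl) := by
    rcases tendsto_atTop_of_antitone hN with h | ⟨Nl, h⟩
    · exfalso
      have h1 := h.atBot_add hφl.neg
      have h2 : Tendsto pot atTop atBot := h1.congr' (by
        filter_upwards [hNe] with t ht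
        rw [← ht]; simp [sub_eq_add_neg])
      obtain ⟨t, ht⟩ := (h2.eventually (eventually_lt_atBot 0)).exists
      have : 0 ≤ pot t := by simp only [hpot]; positivity
      linarith
    · exact ⟨_, (h.sub hφl).congr' hNe⟩
  have hp0 : pl = 0 := by
    by_contra hne
    have hpos : 0 < pl := lt_of_le_of_ne
      (ge_of_tendsto' hp fun t => by simp only [hpot]; positivity) (Ne.symm hne)
    obtain ⟨T₀, hT₀⟩ := eventually_atTop.1 (hp.eventually (lt_mem_nhds (half_lt_self hpos)))
    have hbd : ∀ T, DerivBound (fun t => Real.exp zlim - Real.exp (x t).2.2)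
        (fun s => -(Γ * max (V (x s).1 - ε) 0)) T := by
      intro T t₁ t₂ c h₁ h₁₂ h₂ hc
      have := hA.derivBound_neg_exp_gain hd hθ hδ (hx.mono (Icc_subset_Ici_self : Icc 0 T ⊆ Ici 0))
        t₁ t₂ c h₁ h₁₂ h₂ hc
      simp only at this ⊢
      linarith
    have hvnn : ∀ t, 0 ≤ t → 0 ≤ Real.exp zlim - Real.exp (x t).2.2 := fun t ht =>
      sub_nonneg.2 (Real.exp_le_exp.2 (hzle t ht))
    -- A positive limit makes e^z grow at rate at least Γ√pl, so the nonnegative gap to its limit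
    -- would have to reach the impossible level -1.
    have hev := DerivBound.eventually_le (l := -1) (η := Γ * Real.sqrt pl) (T₀ := max T₀ 0) hbd
      (by have := hx.continuousOn; fun_prop) hvnn (by positivity) (le_max_right _ _) (by
        refine Eventually.of_forall fun s hs _ => ?_
        have h1 := hT₀ s ((le_max_left _ _).trans hs.le)
        have h2 : Real.sqrt pl ≤ max (V (x s).1 - ε) 0 := by
          rw [Real.sqrt_le_left (le_max_right _ _)]
          simp only [hpot] at h1
          linarith
        have := mul_le_mul_of_nonneg_left h2 hΓ.le
        linarith)
    obtain ⟨t, ht, ht0⟩ := (hev.and (eventually_ge_atTop 0)).exists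
    linarith [hvnn t ht0]
  rw [hp0] at hp
  filter_upwards [hp.eventually (gt_mem_nhds (by positivity : 0 < η ^ 2 / 2))] with t ht
  by_contra! hlt
  have h1 : η ≤ max (V (x t).1 - ε) 0 := le_max_of_le_left (by linarith)
  have h2 : η ^ 2 ≤ max (V (x t).1 - ε) 0 ^ 2 := by gcongr
  simp only [hpot] at ht
  linarith

end System

/-! ### Asymptotics under essential limits of the inputs. -/

instance neBot_essAtTop : NeBot essAtTop := by
  rw [essAtTop, inf_neBot_iff]
  intro s hs t ht
  obtain ⟨N, hN⟩ := mem_atTop_sets.1 hs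
  by_contra hne
  rw [not_nonempty_iff_eq_empty] at hne
  have hsub : Ici N ⊆ tᶜ := fun u hu hut => by
    have : u ∈ s ∩ t := ⟨hN u hu, hut⟩
    simp [hne] at this
  have h0 : volume (Ici N) = 0 := measure_mono_null hsub (mem_ae_iff.1 ht)
  simp at h0

lemma eventually_essAtTop {P : ℝ → Prop} (h : ∀ᶠ t in essAtTop, P t) :
    ∃ T₀, 0 ≤ T₀ ∧ ∀ᵐ t, T₀ < t → P t := by
  obtain ⟨s, hs, t, ht, hst⟩ := mem_inf_iff.1 h
  obtain ⟨N, hN⟩ := mem_atTop_sets.1 hs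
  refine ⟨max N 0, le_max_right _ _, ?_⟩
  filter_upwards [ht] with u hu hlt
  have : u ∈ {x | P x} := by
    rw [hst]; exact ⟨hN u ((le_max_left _ _).trans hlt.le), hu⟩
  exact this

lemma eventually_essAtTop_of_ae {P : ℝ → Prop}
    (h : ∀ᵐ t ∂(volume.restrict (Ici (0 : ℝ))), P t) : ∀ᶠ t in essAtTop, P t := by
  rw [ae_restrict_iff' measurableSet_Ici] at h
  have h1 : ∀ᶠ t in essAtTop, t ∈ Ici (0 : ℝ) → P t := (inf_le_right : essAtTop ≤ ae volume) h
  have h2 : ∀ᶠ t in essAtTop, t ∈ Ici (0 : ℝ) :=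
    (inf_le_left : essAtTop ≤ atTop) (eventually_ge_atTop 0)
  filter_upwards [h1, h2] with t ht ht' using ht ht'

section System

variable {n l m p q : ℕ} {S : Plant n l m p q} {V Q k : Vec n → ℝ} {Φ R : Vec l → ℝ}
  {μ : Vec n → ℝ} {r Λ : ℝ} {γ : ℝ → ℝ} {ε Γ a β b C : ℝ}
  {d : ℝ → Vec m} {θ : ℝ → Vec p} {δ : ℝ → Vec q} {x₀ : Vec n × Vec l × ℝ}
  {x : ℝ → Vec n × Vec l × ℝ}

lemma IsSmoothProperPosDef.exists_orderIso_dominating {j : ℕ} {V : Vec j → ℝ}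
    (hV : IsSmoothProperPosDef V) {W : Vec j → ℝ} (hW : Continuous W) (hW0 : W 0 = 0)
    (hWn : ∀ x, 0 ≤ W x) : ∃ σ : ℝ ≃o ℝ, σ 0 = 0 ∧ ∀ x, W x ≤ σ (V x) :=
  DADS.exists_orderIso_dominating hV.smooth.continuous hW hV.radiallyUnbounded hV.nonneg hWn
    fun x hx => by rw [hV.eq_zero hx, hW0]

lemma IsSmoothProperPosDef.tendsto_norm_zero {j : ℕ} {V : Vec j → ℝ}
    (hV : IsSmoothProperPosDef V) {y : ℝ → Vec j}
    (h : Tendsto (fun t => V (y t)) atTop (𝓝 0)) : Tendsto (fun t => ‖y t‖) atTop (𝓝 0) := by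
  obtain ⟨σ, hσ0, hσ⟩ := hV.exists_orderIso_dominating continuous_norm norm_zero norm_nonneg
  have h1 : Tendsto (fun t => σ (V (y t))) atTop (𝓝 0) := by
    rw [← hσ0]
    exact (σ.continuous.tendsto 0).comp h
  exact squeeze_zero (fun t => norm_nonneg _) (fun t => hσ _) h1

/-- A comparison function relating `U` and `Q + R`. -/
lemma AssumptionA.exists_orderIso_lyapU_le (hA : AssumptionA S V Q k Φ R μ r Λ γ) {κ : ℝ}
    (hκ : 0 < κ) :
    ∃ σ : ℝ ≃o ℝ, σ 0 = 0 ∧ ∀ y w, lyapU V Φ r y w ≤ σ (κ * (Q y + R w)) := by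
  have hQc := hA.Q_prop.smooth.continuous
  have hRc := hA.R_prop.smooth.continuous
  have hc : Continuous fun u : Vec n × Vec l => κ * (Q u.1 + R u.2) := by fun_prop
  have hpos : ∀ u : Vec n × Vec l, 0 ≤ Q u.1 ∧ 0 ≤ R u.2 := fun u =>
    ⟨hA.Q_prop.nonneg u.1, hA.R_prop.nonneg u.2⟩
  have hcpt : ∀ M, 0 < M → IsCompact {u : Vec n × Vec l | κ * (Q u.1 + R u.2) ≤ M} := by
    intro M hM
    refine ((hA.Q_prop.radiallyUnbounded (M / κ) (by positivity)).prod
      (hA.R_prop.radiallyUnbounded (M / κ) (by positivity))).of_isClosed_subset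
      (isClosed_le hc continuous_const) fun u hu => ?_
    have hu' : κ * (Q u.1 + R u.2) ≤ M := hu
    obtain ⟨h1, h2⟩ := hpos u
    refine ⟨mem_ofPred.2 ?_, mem_ofPred.2 ?_⟩ <;>
    · rw [le_div_iff₀ hκ]
      nlinarith
  have hzero : ∀ u : Vec n × Vec l, κ * (Q u.1 + R u.2) = 0 → lyapU V Φ r u.1 u.2 = 0 := by
    intro u hu
    obtain ⟨h1, h2⟩ := hpos u
    have h3 : Q u.1 + R u.2 = 0 := by simpa [hκ.ne'] using hu
    rw [hA.Q_prop.eq_zero (by linarith : Q u.1 = 0), hA.R_prop.eq_zero (by linarith : R u.2 = 0)]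
    simp [lyapU, hA.V_prop.map_zero, hA.Φ_prop.map_zero]
  obtain ⟨σ, h0, h⟩ := DADS.exists_orderIso_dominating hc hA.continuous_lyapU hcpt
    (fun u => mul_nonneg hκ.le (add_nonneg (hpos u).1 (hpos u).2))
    (fun u => hA.lyapU_nonneg _ _) hzero
  exact ⟨σ, h0, fun y w => h (y, w)⟩

/-- The asymptotic gain of the unmeasured state. -/
noncomputable def asymptoticGain (γ : ℝ → ℝ) (σΦ σQ : ℝ ≃o ℝ) (s : ℝ) : ℝ :=
  σΦ (γ s + σQ (2 * s) + s)

lemma isGainFunction_asymptoticGain (hγ : IsGainFunction γ) {σΦ σQ : ℝ ≃o ℝ} (hΦ : σΦ 0 = 0)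
    (hQ : σQ 0 = 0) : IsGainFunction (asymptoticGain γ σΦ σQ) := by
  refine ⟨?_, fun s hs t ht hst => ?_, fun s hs => ?_⟩
  · refine σΦ.continuous.comp_continuousOn ((hγ.continuousOn.add ?_).add continuousOn_id)
    exact (σQ.continuous.comp (by fun_prop)).continuousOn
  · refine σΦ.monotone (add_le_add (add_le_add (hγ.monotoneOn hs ht hst) ?_) hst)
    exact σQ.monotone (by linarith)
  · have h1 := hγ.nonneg s hs
    have h2 : 0 ≤ σQ (2 * s) := OrderIso.map_nonneg_of_apply_zero hQ (by linarith)
    exact OrderIso.map_nonneg_of_apply_zero hΦ (by positivity)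

lemma IsLInfty.isBoundedUnder_norm {j : ℕ} {d : ℝ → Vec j} (hd : IsLInfty d) :
    IsBoundedUnder (· ≤ ·) essAtTop fun t => ‖d t‖ :=
  ⟨supNorm d, eventually_map.2 (eventually_essAtTop_of_ae hd.ae_norm_le)⟩

/-- The asymptotic estimate for `Φ`. -/
lemma AssumptionA.eventually_Φ_le (hA : AssumptionA S V Q k Φ R μ r Λ γ) (hε : 0 < ε)
    (hd : IsLInfty d) (hθ : IsLInfty θ) (hδ : IsLInfty δ)
    (hx : IsCaratheodorySolution (closedLoop S V k μ ε Γ a β b C d θ δ) x₀ (Ici 0) x)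
    {σΦ σQ : ℝ ≃o ℝ} (hσΦ : ∀ w, Φ w ≤ σΦ (R w)) (hσQ : ∀ y, Q y ≤ σQ (V y))
    (hV : ∀ η, 0 < η → ∀ᶠ t in atTop, V (x t).1 ≤ ε + η) :
    ∀ᶠ t in atTop,
      Φ (x t).2.1 ≤ asymptoticGain γ σΦ σQ (ε + limsup (fun t => ‖δ t‖) essAtTop) := by
  set L := limsup (fun t => ‖δ t‖) essAtTop with hL
  have hL0 : 0 ≤ L := by
    refine le_limsup_of_le hδ.isBoundedUnder_norm fun c hc => ?_
    obtain ⟨t, ht⟩ := hc.exists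
    exact (norm_nonneg _).trans ht
  obtain ⟨T₁, hT₁, h₁⟩ := eventually_essAtTop
    (eventually_lt_of_limsup_lt (by linarith : L < ε + L) hδ.isBoundedUnder_norm)
  -- The margin η = ε gives V ≤ 2ε ≤ 2(ε + L), whence the factor 2 in `asymptoticGain`.
  obtain ⟨T₂, h₂⟩ := eventually_atTop.1 (hV ε hε)
  have hΦc : ContinuousOn (fun t => Φ (x t).2.1) (Ici 0) := by
    have h1 := hA.Φ_prop.smooth.continuous
    have h2 := hx.continuousOn
    fun_prop
  refine DerivBound.eventually_le (η := ε + L) (T₀ := max T₁ T₂)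
    (fun T => hA.derivBound_Φ hd hθ hδ (hx.mono (Icc_subset_Ici_self : Icc 0 T ⊆ Ici 0)))
    hΦc (fun t _ => hA.Φ_prop.nonneg _) (by linarith) (hT₁.trans (le_max_left _ _)) ?_
  filter_upwards [h₁] with s hs hTs hlt
  have hδs := (hs ((le_max_left _ _).trans_lt hTs)).le
  have hVs := h₂ s ((le_max_right _ _).trans hTs.le)
  have hγs := hA.γ_prop.monotoneOn (mem_Ici.2 (norm_nonneg (δ s)))
    (mem_Ici.2 (by linarith : 0 ≤ ε + L)) hδs
  have hQs : Q (x s).1 ≤ σQ (2 * (ε + L)) := (hσQ _).trans (σQ.monotone (by linarith))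
  -- The last summand of the argument of σΦ leaves a strict decay rate ε + L above the level, so Φ
  -- reaches it in finite time.
  have hRs := σΦ.lt_iff_lt.1 (hlt.trans_le (hσΦ (x s).2.1))
  linarith

/-- The convergence result for vanishing inputs. -/
lemma AssumptionA.tendsto_zero (hA : AssumptionA S V Q k Φ R μ r Λ γ)
    (ha : 0 < a) (ha1 : a ≤ 1) (hβ : 0 < β) (hβ1 : β ≤ 1) (hb : 1 ≤ b) (hC : 1 ≤ C)
    {σ : ℝ ≃o ℝ} (hσ0 : σ 0 = 0)
    (hσ : ∀ y w, lyapU V Φ r y w ≤ σ ((r / 2 - a * β / b) / 2 * (Q y + R w)))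
    (hd : IsLInfty d) (hθ : IsLInfty θ) (hδ : IsLInfty δ)
    (hx : IsCaratheodorySolution (closedLoop S V k μ ε Γ a β b C d θ δ) x₀ (Ici 0) x)
    {zlim : ℝ} (hz : Tendsto (fun t => (x t).2.2) atTop (𝓝 zlim)) (hγ0 : γ 0 = 0) (hΛ : Λ = 0)
    (hd0 : Tendsto d essAtTop (𝓝 0)) (hδ0 : Tendsto δ essAtTop (𝓝 0)) {θ₀ : Vec p}
    (hθ₀ : ∀ᵐ t ∂(volume.restrict (Ici (0 : ℝ))), θ t = θ₀)
    (hle : ‖θ₀‖ - b ≤ Real.exp zlim) :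
    Tendsto (fun t => lyapU V Φ r (x t).1 (x t).2.1) atTop (𝓝 0) := by
  have hχ : Tendsto (fun t => chi γ r Λ a β b ‖d t‖ ‖δ t‖ ‖θ t‖ (Real.exp (x t).2.2)) essAtTop
      (𝓝 0) := by
    have hE : Tendsto (fun t => Real.exp (x t).2.2) essAtTop (𝓝 (Real.exp zlim)) :=
      ((Real.continuous_exp.tendsto zlim).comp hz).mono_left inf_le_left
    have hγ : Tendsto (fun t => γ ‖δ t‖) essAtTop (𝓝 0) := by
      have h1 := hA.γ_prop.continuousOn 0 self_mem_Ici
      rw [ContinuousWithinAt, hγ0] at h1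
      refine h1.comp (tendsto_nhdsWithin_iff.2 ⟨?_, Eventually.of_forall fun t => norm_nonneg _⟩)
      simpa using hδ0.norm
    have hdn : Tendsto (fun t => ‖d t‖) essAtTop (𝓝 0) := by simpa using hd0.norm
    have hθn : Tendsto (fun t => ‖θ t‖) essAtTop (𝓝 ‖θ₀‖) := by
      refine tendsto_const_nhds.congr' ?_
      filter_upwards [eventually_essAtTop_of_ae hθ₀] with t ht
      rw [ht]
    -- The excess of θ over the limiting gain is 0 exactly because |θ₀| - b ≤ e^{zlim}.
    have hs : Tendsto (fun t => max (‖θ t‖ - b - Real.exp (x t).2.2) 0) essAtTop (𝓝 0) := by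
      have h1 := ((hθn.sub_const b).sub hE).max (tendsto_const_nhds (x := (0 : ℝ)))
      rwa [max_eq_right (by linarith)] at h1
    have hden : b + Real.exp zlim ≠ 0 := by have := Real.exp_pos zlim; positivity
    have hfin := (hγ.const_mul (r / 2)).add
      ((((((hdn.pow 2).add (hdn.pow 4)).add (hs.pow 2)).add (hs.pow 4)).add_const
        (2 * β * Λ)).div (hE.const_add b) hden |>.const_mul a)
    simpa [chi, hΛ] using hfin
  have hUc : ContinuousOn (fun t => lyapU V Φ r (x t).1 (x t).2.1) (Ici 0) :=
    hA.continuous_lyapU.comp_continuousOn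
      (by have := hx.continuousOn; fun_prop :
        ContinuousOn (fun t => ((x t).1, (x t).2.1)) (Ici 0))
  rw [tendsto_order]
  refine ⟨fun c hc => Eventually.of_forall fun t => hc.trans_le (hA.lyapU_nonneg _ _),
    fun c hc => ?_⟩
  have hη : 0 < σ.symm (c / 2) := by
    rw [OrderIso.lt_symm_apply, hσ0]; positivity
  obtain ⟨T₀, hT₀, h₀⟩ := eventually_essAtTop (hχ.eventually (gt_mem_nhds hη))
  have hev := DerivBound.eventually_le (l := c / 2) (η := σ.symm (c / 2)) (T₀ := T₀)
    (fun T => hA.derivBound_lyapU ha ha1 hβ hβ1 hb hC hd hθ hδ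
      (hx.mono (Icc_subset_Ici_self : Icc 0 T ⊆ Ici 0)))
    hUc (fun t _ => hA.lyapU_nonneg _ _) hη hT₀ (by
      filter_upwards [h₀] with s hs hTs hlt
      have h1 := hs hTs
      have h2 : σ.symm (lyapU V Φ r (x s).1 (x s).2.1)
          ≤ (r / 2 - a * β / b) / 2 * (Q (x s).1 + R (x s).2.1) := by
        rw [OrderIso.symm_apply_le]; exact hσ _ _
      have h3 : σ.symm (c / 2) ≤ σ.symm (lyapU V Φ r (x s).1 (x s).2.1) :=
        σ.symm.monotone hlt.le
      linarith)
  filter_upwards [hev] with t ht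
  linarith

end System

end DADS

/-! ### Assembly of the main theorem. -/

theorem theorem1 {n l m p q : ℕ} (S : DADS.Plant n l m p q)
    (V Q k : DADS.Vec n → ℝ) (Φ R : DADS.Vec l → ℝ) (μ : DADS.Vec n → ℝ)
    (r Λ : ℝ) (γ : ℝ → ℝ) (hA : DADS.AssumptionA S V Q k Φ R μ r Λ γ)
    (ε Γ a β b C : ℝ) (hε : 0 < ε) (hΓ : 0 < Γ) (ha : 0 < a) (ha1 : a ≤ 1)
    (hβ : 0 < β) (hβ1 : β ≤ 1) (hb : 1 ≤ b) (hC : 1 ≤ C) (hab : 2 * a * β < b * r) :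
    ∃ (om : ℝ → ℝ → ℝ) (ζ ζt : ℝ → ℝ)
      (B : (DADS.Vec n × DADS.Vec l × ℝ) × (ℝ × ℝ × ℝ) → ℝ),
      DADS.IsClassKL om ∧ DADS.IsClassKInfty ζ ∧ DADS.IsGainFunction ζt ∧ Continuous B ∧
      (γ 0 = 0 → ζt 0 = 0) ∧
      ∀ (y₀ : DADS.Vec n) (w₀ : DADS.Vec l) (z₀ : ℝ)
        (d : ℝ → DADS.Vec m) (θ : ℝ → DADS.Vec p) (δ : ℝ → DADS.Vec q),
        DADS.IsLInfty d → DADS.IsLInfty θ → DADS.IsLInfty δ →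
        ∃ (y : ℝ → DADS.Vec n) (w : ℝ → DADS.Vec l) (z : ℝ → ℝ),
          -- `(y, w, z)` is a solution defined for all `t ≥ 0`
          DADS.IsCaratheodorySolution (DADS.closedLoop S V k μ ε Γ a β b C d θ δ)
            (y₀, w₀, z₀) (Ici 0) (fun t => (y t, w t, z t)) ∧
          -- every solution on an interval `[0, T)` coincides with it there
          (∀ (T : ℝ) (x : ℝ → DADS.Vec n × DADS.Vec l × ℝ), 0 < T →
            DADS.IsCaratheodorySolution (DADS.closedLoop S V k μ ε Γ a β b C d θ δ)
              (y₀, w₀, z₀) (Ico 0 T) x →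
            EqOn x (fun t => (y t, w t, z t)) (Ico 0 T)) ∧
          -- asymptotic estimate for the measured state
          (IsBoundedUnder (· ≤ ·) atTop (fun t => V (y t)) ∧
            limsup (fun t => V (y t)) atTop ≤ ε) ∧
          -- asymptotic estimate for the unmeasured state
          (IsBoundedUnder (· ≤ ·) atTop (fun t => Φ (w t)) ∧
            limsup (fun t => Φ (w t)) atTop
              ≤ ζt (ε + limsup (fun t => ‖δ t‖) DADS.essAtTop)) ∧
          -- practical input-to-output stability estimate
          (∀ t, 0 ≤ t → DADS.lyapU V Φ r (y t) (w t)
              ≤ om (DADS.lyapU V Φ r y₀ w₀) t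
                + ζ (DADS.chi γ r Λ a β b (DADS.supNorm d) (DADS.supNorm δ)
                    (DADS.supNorm θ) (Real.exp z₀))) ∧
          MonotoneOn z (Ici 0) ∧
          ∃ zlim : ℝ, Tendsto z atTop (𝓝 zlim) ∧
            -- bounds for the dynamic gain
            (∀ t, 0 ≤ t → z₀ ≤ z t ∧ z t ≤ zlim) ∧
            zlim ≤ B ((y₀, w₀, z₀),
              (DADS.supNorm d, DADS.supNorm δ, DADS.supNorm θ)) ∧
            -- the vanishing case
            (γ 0 = 0 → Λ = 0 → Tendsto d DADS.essAtTop (𝓝 0) →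
              Tendsto δ DADS.essAtTop (𝓝 0) →
              ∀ θ₀ : DADS.Vec p, (∀ᵐ t ∂(volume.restrict (Ici (0 : ℝ))), θ t = θ₀) →
                (Tendsto (fun t => ‖y t‖) atTop (𝓝 0) ∧
                  Tendsto (fun t => ‖w t‖) atTop (𝓝 0)) ∨
                (b < ‖θ₀‖ ∧ zlim < Real.log (‖θ₀‖ - b))) := by
  have hr := hA.r_pos
  obtain ⟨hκ, hκ'⟩ := hA.rate_pos hb hab
  obtain ⟨σ, hσ0, hσ⟩ := hA.exists_orderIso_lyapU_le (half_pos hκ)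
  obtain ⟨σR, hσR0, hσR⟩ := hA.Φ_prop.exists_orderIso_dominating hA.R_prop.smooth.continuous
    hA.R_prop.map_zero hA.R_prop.nonneg
  obtain ⟨σΦ, hσΦ0, hσΦ⟩ := hA.R_prop.exists_orderIso_dominating hA.Φ_prop.smooth.continuous
    hA.Φ_prop.map_zero hA.Φ_prop.nonneg
  obtain ⟨σV, hσV0, hσV⟩ := hA.Q_prop.exists_orderIso_dominating hA.V_prop.smooth.continuous
    hA.V_prop.map_zero hA.V_prop.nonneg
  obtain ⟨σQ, hσQ0, hσQ⟩ := hA.V_prop.exists_orderIso_dominating hA.Q_prop.smooth.continuous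
    hA.Q_prop.map_zero hA.Q_prop.nonneg
  have hσs := OrderIso.symm_apply_zero_of_apply_zero hσ0
  have hqε : 0 < σV.symm ε := by rw [OrderIso.lt_symm_apply, hσV0]; exact hε
  -- Since V ≤ σV(Q), V ≥ ε forces Q ≥ σV⁻¹(ε); `P` is the resulting decay of V outside the target
  -- set.
  set P := (r - a * β / b) * σV.symm ε with hPdef
  have hP0 : 0 < P := mul_pos hκ' hqε
  have hP : ∀ y, ε ≤ V y → P ≤ (r - a * β / b) * Q y := by
    intro y hy
    refine mul_le_mul_of_nonneg_left ?_ hκ'.le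
    rw [OrderIso.symm_apply_le]
    exact hy.trans (hσV y)
  refine ⟨DADS.decayKL σ.symm, σ, DADS.asymptoticGain γ σΦ σQ,
    DADS.gainLimitBound V Φ γ r Λ ε Γ a β b σ σR P, DADS.isClassKL_decayKL hσs,
    OrderIso.isClassKInfty σ hσ0, DADS.isGainFunction_asymptoticGain hA.γ_prop hσΦ0 hσQ0,
    hA.continuous_gainLimitBound hb hΓ σ σR hP0, fun hγ0 => ?_, ?_⟩
  · simp [DADS.asymptoticGain, hγ0, hσΦ0, hσQ0]
  intro y₀ w₀ z₀ d θ δ hd hθ hδ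
  have hap : ∀ T x, DADS.IsCaratheodorySolution (DADS.closedLoop S V k μ ε Γ a β b C d θ δ)
      (y₀, w₀, z₀) (Icc 0 T) x → _ := fun T x hx =>
    hA.apriori_bounds hΓ ha ha1 hβ hβ1 hb hC hσ0 hσR0 hσ hσR hP0 hP hd hθ hδ hx
  obtain ⟨x, hx⟩ := hA.exists_solution hΓ hd hθ hδ
    fun T x hx t ht => ⟨(hap T x hx).1 t ht, (hap T x hx).2.2 t ht⟩
  have hxT : ∀ T, DADS.IsCaratheodorySolution (DADS.closedLoop S V k μ ε Γ a β b C d θ δ)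
      (y₀, w₀, z₀) (Icc 0 T) x := fun T => hx.mono Icc_subset_Ici_self
  have hmono : MonotoneOn (fun t => (x t).2.2) (Ici 0) := fun s hs t ht hst =>
    hA.monotoneOn_gain hΓ hd hθ hδ (hxT t) ⟨hs, hst⟩ ⟨ht, le_rfl⟩ hst
  have hanti : AntitoneOn (fun t => DADS.gainLyap V ε Γ b P (DADS.perturbationBound V Φ γ r Λ a β b
      σ σR ((y₀, w₀, z₀), (DADS.supNorm d, DADS.supNorm δ, DADS.supNorm θ))) (x t)) (Ici 0) :=
    fun s hs t ht hst => (hap t x (hxT t)).2.1 ⟨hs, hst⟩ ⟨ht, le_rfl⟩ hst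
  set B := DADS.gainLimitBound V Φ γ r Λ ε Γ a β b σ σR P
    ((y₀, w₀, z₀), (DADS.supNorm d, DADS.supNorm δ, DADS.supNorm θ))
  have hzB : ∀ t, 0 ≤ t → (x t).2.2 ≤ B := fun t ht => (hap t x (hxT t)).2.2 t ⟨ht, le_rfl⟩
  have hz' : Monotone fun t => (x (max t 0)).2.2 := fun s t hst =>
    hmono (mem_Ici.2 (le_max_right _ _)) (mem_Ici.2 (le_max_right _ _)) (max_le_max_right 0 hst)
  have hbdd : BddAbove (range fun t => (x (max t 0)).2.2) :=
    ⟨B, by rintro _ ⟨t, rfl⟩; exact hzB _ (le_max_right _ _)⟩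
  set zlim := ⨆ t, (x (max t 0)).2.2 with hzlim
  have hz : Tendsto (fun t => (x t).2.2) atTop (𝓝 zlim) :=
    (tendsto_atTop_ciSup hz' hbdd).congr' (by
      filter_upwards [eventually_ge_atTop 0] with t ht
      rw [max_eq_left ht])
  have hzle : ∀ t, 0 ≤ t → (x t).2.2 ≤ zlim := fun t ht => by
    have := le_ciSup hbdd t
    simpa [max_eq_left ht] using this
  have hVev : ∀ η, 0 < η → ∀ᶠ t in atTop, V (x t).1 ≤ ε + η := fun η hη =>
    hA.eventually_V_le hΓ hb hd hθ hδ hx hanti hz hzle hη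
  have hΦev := hA.eventually_Φ_le hε hd hθ hδ hx hσΦ hσQ hVev
  have hVcob : IsCoboundedUnder (· ≤ ·) atTop fun t => V (x t).1 :=
    isCoboundedUnder_le_of_le atTop (x := 0) fun t => hA.V_prop.nonneg _
  have hΦcob : IsCoboundedUnder (· ≤ ·) atTop fun t => Φ (x t).2.1 :=
    isCoboundedUnder_le_of_le atTop (x := 0) fun t => hA.Φ_prop.nonneg _
  refine ⟨fun t => (x t).1, fun t => (x t).2.1, fun t => (x t).2.2, hx, ?_, ⟨?_, ?_⟩, ⟨?_, ?_⟩,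
    ?_, hmono, zlim, hz, fun t ht => ⟨?_, hzle t ht⟩, ?_, ?_⟩
  · intro T x' _ hx' t ht
    exact DADS.IsCaratheodorySolution.eqOn (v := fun t => (d t, θ t, δ t))
      (hA.locallyLipschitz_closedLoopMap (ε := ε) (Γ := Γ) (a := a) (β := β) (b := b) (C := C))
      (DADS.ae_norm_inputs_le hd hθ hδ)
      (hx'.mono fun s hs => ⟨hs.1, hs.2.trans_lt ht.2⟩) (hxT t) ⟨ht.1, le_rfl⟩
  · exact ⟨ε + 1, eventually_map.2 (hVev 1 one_pos)⟩
  · exact le_of_forall_pos_le_add fun η hη => limsup_le_of_le hVcob (hVev η hη)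
  · exact ⟨_, eventually_map.2 hΦev⟩
  · exact limsup_le_of_le hΦcob hΦev
  · intro t ht
    exact hA.lyapU_le hΓ ha ha1 hβ hβ1 hb hC hσ0 hσ hd hθ hδ (hxT t) ⟨ht, le_rfl⟩
  · exact hA.le_gain hΓ hd hθ hδ (hxT t) ⟨ht, le_rfl⟩
  · exact ciSup_le fun t => hzB _ (le_max_right _ _)
  · intro hγ0 hΛ hd0 hδ0 θ₀ hθ₀
    refine or_iff_not_imp_right.2 fun hnot => ?_
    -- Otherwise |θ₀| - b exceeds a positive number, and taking logarithms gives the excluded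
    -- alternative.
    have hle : ‖θ₀‖ - b ≤ Real.exp zlim := by
      by_contra! hlt
      have hpos : 0 < ‖θ₀‖ - b := (Real.exp_pos _).trans hlt
      exact hnot ⟨by linarith, (Real.lt_log_iff_exp_lt hpos).2 hlt⟩
    have hU := hA.tendsto_zero ha ha1 hβ hβ1 hb hC hσ0 hσ hd hθ hδ hx hz hγ0 hΛ hd0 hδ0 hθ₀ hle
    constructor
    · refine hA.V_prop.tendsto_norm_zero (squeeze_zero (fun t => hA.V_prop.nonneg _)
        (fun t => ?_) hU)
      have := hA.Φ_prop.nonneg (x t).2.1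
      unfold DADS.lyapU
      have : 0 ≤ r / 2 * Φ (x t).2.1 := by positivity
      linarith
    · have hU' := hU.const_mul (2 / r)
      rw [mul_zero] at hU'
      refine hA.Φ_prop.tendsto_norm_zero (squeeze_zero (fun t => hA.Φ_prop.nonneg _)
        (fun t => ?_) hU')
      have := hA.V_prop.nonneg (x t).1
      unfold DADS.lyapU
      rw [div_mul_eq_mul_div, le_div_iff₀ hr]
      linarith
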